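/- For $c\in\mathbb{R}$ let $\mathbb{H}_c=L^2(\mathbb{R},e^{-2ct}\,dt)$ (complex-valued functions), and let $\partial_c$ be the unbounded operator $\partial_c f=f'$ on $\mathbb{H}_c$ with domain $D(\partial_c)=\{f\in\mathbb{H}_c\cap AC(\mathbb{R}) : f'\in\mathbb{H}_c\}$, where $AC(\mathbb{R})$ is the space of locally absolutely continuous functions. The operator $V_c=\frac{1}{i}(\partial_c-c)$ is self-adjoint, and $\partial_c=c+iV_c$ is normal. The spectral operator is $\mathfrak{a}_c=\zeta(\partial_c)$, where $\zeta$ is the Riemann zeta function; here and below functions of (possibly unbounded) normal operators are given by the measurable functional calculus. For $T>0$, a $T$-admissible cut-off function is a continuous function $\phi^{(T)}:\mathbb{R}\to\mathbb{R}$ the closure of whose range is $[-T,T]$; the truncated infinitesimal shift and the truncated spectral operator are $$\partial_c^{(T)}=c+i\,\phi^{(T)}(V_c),\qquad \mathfrak{a}_c^{(T)}=\zeta\bigl(\partial_c^{(T)}\bigr).$$ An operator $A$ on $\mathbb{H}_c$ with domain $D(A)$ is invertible if there is a bounded operator $B$ on $\mathbb{H}_c$ with range $D(A)$ such that $ABu=u$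 for all $u\in\mathbb{H}_c$ and $BAv=v$ for all $v\in D(A)$. The spectral operator $\mathfrak{a}_c$ is quasi-invertible if $\mathfrak{a}_c^{(T)}$ is invertible for every $T>0$. **Theorem.** For each $c\in(0,1)$ and $T>0$ let $\phi_c^{(T)}$ be an arbitrary $T$-admissible cut-off function, used to form $\mathfrak{a}_c^{(T)}$. Then the following are equivalent: 1. $\mathfrak{a}_c$ is quasi-invertible for every $c\in(0,1)\setminus\{\tfrac12\}$; 2. $\mathfrak{a}_c$ is quasi-invertible for every $c\in(\tfrac12,1)$; 3. the Riemann hypothesis is true. -/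

import Mathlib

open MeasureTheory Set
open scoped InnerProductSpace ENNReal

noncomputable section

namespace SpectralOperator

/-! ### Measurable functional calculus for unbounded normal operators -/

section FunctionalCalculus

variable {H : Type*} [NormedAddCommGroup H] [InnerProductSpace ℂ H] [CompleteSpace H]

/-- A resolution of the identity (projection-valued measure) on the Borel sets of `ℂ`.  The values
on sets that are not measurable play no role. -/
structure ResolutionOfIdentity (H : Type*) [NormedAddCommGroup H] [InnerProductSpace ℂ H]
    [CompleteSpace H] where
  proj : Set ℂ → H →L[ℂ] H
  isStarProjection : ∀ s, MeasurableSet s → IsStarProjection (proj s)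
  empty : proj ∅ = 0
  univ : proj Set.univ = 1
  inter : ∀ s t, MeasurableSet s → MeasurableSet t → proj (s ∩ t) = proj s * proj t
  iUnion : ∀ s : ℕ → Set ℂ, (∀ n, MeasurableSet (s n)) → Pairwise (Function.onFun Disjoint s) →
    ∀ x, HasSum (fun n => proj (s n) x) (proj (⋃ n, s n) x)

namespace ResolutionOfIdentity

theorem inner_proj_self (E : ResolutionOfIdentity H) {s : Set ℂ} (hs : MeasurableSet s) (x : H) :
    ⟪x, E.proj s x⟫_ℂ = ((‖E.proj s x‖ ^ 2 : ℝ) : ℂ) := by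
  have h := E.isStarProjection s hs
  have h1 : E.proj s (E.proj s x) = E.proj s x := by
    have := h.isIdempotentElem
    exact congrArg (fun A : H →L[ℂ] H => A x) this
  have h2 : ContinuousLinearMap.adjoint (E.proj s) = E.proj s := h.isSelfAdjoint
  calc ⟪x, E.proj s x⟫_ℂ = ⟪x, E.proj s (E.proj s x)⟫_ℂ := by rw [h1]
    _ = ⟪E.proj s x, E.proj s x⟫_ℂ := by
        conv_lhs => rw [← h2]
        rw [ContinuousLinearMap.adjoint_inner_right, h2]
    _ = _ := by rw [inner_self_eq_norm_sq_to_K]; push_cast; rfl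

theorem enorm_sq_iUnion (E : ResolutionOfIdentity H) (x : H) (s : ℕ → Set ℂ)
    (hs : ∀ n, MeasurableSet (s n)) (hd : Pairwise (Function.onFun Disjoint s)) :
    ENNReal.ofReal (‖E.proj (⋃ n, s n) x‖ ^ 2) = ∑' n, ENNReal.ofReal (‖E.proj (s n) x‖ ^ 2) := by
  have h1 := (E.iUnion s hs hd x).mapL (innerSL ℂ x)
  simp only [innerSL_apply_apply, E.inner_proj_self (hs _), E.inner_proj_self (.iUnion hs)] at h1
  have h2 : HasSum (fun n => ‖E.proj (s n) x‖ ^ 2) (‖E.proj (⋃ n, s n) x‖ ^ 2) := by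
    exact_mod_cast h1
  rw [← h2.tsum_eq, ENNReal.ofReal_tsum_of_nonneg (fun _ => by positivity) h2.summable]

/-- The scalar measure `E_x(s) = ⟨E(s) x, x⟩ = ‖E(s) x‖²`. -/
def scalarMeasure (E : ResolutionOfIdentity H) (x : H) : Measure ℂ :=
  Measure.ofMeasurable (fun s _ => ENNReal.ofReal (‖E.proj s x‖ ^ 2))
    (by simp [E.empty]) (fun s hs hd => E.enorm_sq_iUnion x s hs hd)

/-- `A = ∫ f dE`: the domain of `A` is `{x | ∫ |f|² dE_x < ∞}`, and `⟨A x, x⟩ = ∫ f dE_x` for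
every `x` in this domain.  (Mathlib's inner product is linear in the second variable.)  Since the
domain is a dense subspace, by polarization there is only one such `A`. -/
def IsIntegral (E : ResolutionOfIdentity H) (f : ℂ → ℂ) (A : H →ₗ.[ℂ] H) : Prop :=
  (∀ x : H, x ∈ A.domain ↔ ∫⁻ z, ‖f z‖ₑ ^ 2 ∂(E.scalarMeasure x) < ∞) ∧
    ∀ x : A.domain, ⟪(x : H), A x⟫_ℂ = ∫ z, f z ∂(E.scalarMeasure (x : H))

end ResolutionOfIdentity

/-- `A = f(N)`: there is a resolution of the identity `E` with `N = ∫ z dE(z)` (the spectral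
measure of `N`) and `A = ∫ f(z) dE(z)`. -/
def IsFunctionOf (f : ℂ → ℂ) (N A : H →ₗ.[ℂ] H) : Prop :=
  ∃ E : ResolutionOfIdentity H, E.IsIntegral (fun z => z) N ∧ E.IsIntegral f A

open Classical in
/-- The operator `f(N)` given by the measurable functional calculus, for `N` a possibly unbounded
normal operator and `f` a Borel function.  By the spectral theorem `f(N)` exists and is unique; the
junk value, for other `N`, is the zero operator on the zero subspace. -/
def functionalCalculus (f : ℂ → ℂ) (N : H →ₗ.[ℂ] H) : H →ₗ.[ℂ] H :=
  if h : ∃ A, IsFunctionOf f N A then h.choose else ⊥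

/-- Multiplication by the constant `a`, as an everywhere defined operator. -/
def constOp (H : Type*) [NormedAddCommGroup H] [InnerProductSpace ℂ H] (a : ℂ) : H →ₗ.[ℂ] H :=
  (a • (LinearMap.id : H →ₗ[ℂ] H)).toPMap ⊤

/-- A possibly unbounded operator `A` is invertible if it has an inverse that is bounded and defined
on the whole space. -/
def IsInvertible (A : H →ₗ.[ℂ] H) : Prop :=
  ∃ B : H →L[ℂ] H, Set.range B = (A.domain : Set H) ∧
    (∀ (u : H) (hu : B u ∈ A.domain), A ⟨B u, hu⟩ = u) ∧ ∀ v : A.domain, B (A v) = v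

end FunctionalCalculus

/-! ### The weighted space and the infinitesimal shift -/

/-- The measure `μ_c(dt) = e^{-2ct} dt` on the real line. -/
def weightMeasure (c : ℝ) : Measure ℝ :=
  (volume : Measure ℝ).withDensity (fun t => ENNReal.ofReal (Real.exp (-2 * c * t)))

/-- The Hilbert space `ℍ_c = L²(ℝ, μ_c)` of complex-valued functions. -/
abbrev HilbertSpace (c : ℝ) : Type := Lp ℂ 2 (weightMeasure c)

/-- The graph of the infinitesimal shift: pairs `(f, g)` of elements of `ℍ_c` such that `f` is
(a.e. equal to) a locally absolutely continuous function whose a.e. derivative is `g`. -/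
def shiftGraph (c : ℝ) : Submodule ℂ (HilbertSpace c × HilbertSpace c) where
  carrier := {p | ∃ F : ℝ → ℂ, (∀ a b : ℝ, AbsolutelyContinuousOnInterval F a b) ∧
    (∀ᵐ t ∂(weightMeasure c), p.1 t = F t) ∧ ∀ᵐ t ∂(weightMeasure c), HasDerivAt F (p.2 t) t}
  zero_mem' := by
    refine ⟨fun _ => 0, fun a b => ?_, Lp.coeFn_zero ℂ 2 _, ?_⟩
    · exact (LipschitzWith.const (0 : ℂ)).lipschitzOnWith.absolutelyContinuousOnInterval
    · filter_upwards [Lp.coeFn_zero ℂ 2 (weightMeasure c)] with t ht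
      have : (0 : HilbertSpace c × HilbertSpace c).2 t = 0 := ht
      rw [this]
      exact hasDerivAt_const t 0
  add_mem' := by
    rintro p q ⟨F, hF, hpF, hF'⟩ ⟨G, hG, hqG, hG'⟩
    refine ⟨F + G, fun a b => (hF a b).add (hG a b), ?_, ?_⟩
    · filter_upwards [hpF, hqG, Lp.coeFn_add p.1 q.1] with t h1 h2 h3
      rw [Prod.fst_add, h3, Pi.add_apply, h1, h2, Pi.add_apply]
    · filter_upwards [hF', hG', Lp.coeFn_add p.2 q.2] with t h1 h2 h3
      rw [Prod.snd_add, h3]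
      exact h1.add h2
  smul_mem' := by
    rintro a p ⟨F, hF, hpF, hF'⟩
    refine ⟨a • F, fun x y => (hF x y).const_smul a, ?_, ?_⟩
    · filter_upwards [hpF, Lp.coeFn_smul a p.1] with t h1 h3
      rw [Prod.smul_fst, h3, Pi.smul_apply, h1, Pi.smul_apply]
    · filter_upwards [hF', Lp.coeFn_smul a p.2] with t h1 h3
      rw [Prod.smul_snd, h3]
      exact h1.const_smul a

theorem volume_absolutelyContinuous_weightMeasure (c : ℝ) :
    (volume : Measure ℝ) ≪ weightMeasure c :=
  withDensity_absolutelyContinuous' (by fun_prop)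
    (Filter.Eventually.of_forall fun t => by simp [Real.exp_pos])

/-- The graph is single-valued, so that it is the graph of an operator. -/
theorem shiftGraph_single_valued (c : ℝ) (p : HilbertSpace c × HilbertSpace c)
    (hp : p ∈ shiftGraph c) (h0 : p.1 = 0) : p.2 = 0 := by
  obtain ⟨F, hF, hpF, hF'⟩ := hp
  have hcont : Continuous F := by
    rw [continuous_iff_continuousAt]
    intro t
    have := (hF (t - 1) (t + 1)).continuousOn
    rw [uIcc_of_le (by linarith)] at this
    exact this.continuousAt (Icc_mem_nhds (by linarith) (by linarith))
  have hz : ∀ᵐ t ∂(weightMeasure c), F t = 0 := by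
    filter_upwards [hpF, Lp.coeFn_zero ℂ 2 (weightMeasure c)] with t h1 h2
    rw [← h1, h0, h2, Pi.zero_apply]
  have hF0 : F = fun _ => 0 :=
    (hcont.ae_eq_iff_eq volume continuous_const).1
      ((volume_absolutelyContinuous_weightMeasure c).ae_le hz)
  rw [Lp.eq_zero_iff_ae_eq_zero]
  filter_upwards [hF'] with t ht
  rw [hF0] at ht
  exact ht.unique (hasDerivAt_const t 0)

/-- The infinitesimal shift `∂_c f = f'` on
`D(∂_c) = {f ∈ ℍ_c ∩ AC(ℝ) | f' ∈ ℍ_c}`. -/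
def infinitesimalShift (c : ℝ) : HilbertSpace c →ₗ.[ℂ] HilbertSpace c :=
  (shiftGraph c).toLinearPMap

theorem infinitesimalShift_graph (c : ℝ) : (infinitesimalShift c).graph = shiftGraph c :=
  Submodule.toLinearPMap_graph_eq _ (shiftGraph_single_valued c)

/-- The spectral operator `𝔞_c = ζ(∂_c)`, with domain `{f ∈ D(∂_c) | ζ(∂_c) f ∈ ℍ_c}`. -/
def spectralOperator (c : ℝ) : HilbertSpace c →ₗ.[ℂ] HilbertSpace c :=
  (functionalCalculus riemannZeta (infinitesimalShift c)).domRestrict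
    (infinitesimalShift c).domain

/-- The self-adjoint operator `V_c = (∂_c - c) / i`, so that `∂_c = c + i V_c`. -/
def momentum (c : ℝ) : HilbertSpace c →ₗ.[ℂ] HilbertSpace c :=
  (Complex.I)⁻¹ • (infinitesimalShift c - constOp (HilbertSpace c) c)

/-! ### Truncations and quasi-invertibility -/

/-- `T`-admissible cut-off functions (for `c ≠ 1`): continuous functions on `ℝ` the closure of whose
range is `[-T, T]`. -/
def IsAdmissibleCutoff (T : ℝ) (φ : ℝ → ℝ) : Prop :=
  Continuous φ ∧ closure (Set.range φ) = Set.Icc (-T) T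

/-- The truncated infinitesimal shift `∂_c^{(T)} = c + i φ(V_c)`, for the cut-off function `φ`.
The spectral measure of the self-adjoint operator `V_c` lives on the real line, so that `φ` may be
extended to `ℂ` as `z ↦ φ (re z)`. -/
def truncatedShift (c : ℝ) (φ : ℝ → ℝ) : HilbertSpace c →ₗ.[ℂ] HilbertSpace c :=
  constOp (HilbertSpace c) c +
    Complex.I • functionalCalculus (fun z => (φ z.re : ℂ)) (momentum c)

/-- The truncated spectral operator `𝔞_c^{(T)} = ζ(∂_c^{(T)})`. -/
def truncatedSpectralOperator (c : ℝ) (φ : ℝ → ℝ) : HilbertSpace c →ₗ.[ℂ] HilbertSpace c :=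
  functionalCalculus riemannZeta (truncatedShift c φ)

/-- Quasi-invertibility of the spectral operator `𝔞_c`: its truncation `𝔞_c^{(T)}`, formed with the
cut-off function `φ T`, is invertible for every `T > 0`. -/
def IsQuasiInvertible (c : ℝ) (φ : ℝ → ℝ → ℝ) : Prop :=
  ∀ T : ℝ, 0 < T → IsInvertible (truncatedSpectralOperator c (φ T))

end SpectralOperator

end

namespace SpectralOperator

section Abstract

variable {H : Type*} [NormedAddCommGroup H] [InnerProductSpace ℂ H]

/-- An operator whose numerical radius is at most `r` has norm at most `2 * r`. -/
theorem norm_map_le_of_numericalRadius_le (T : H →ₗ[ℂ] H) {r : ℝ} (hr : 0 ≤ r)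
    (hT : ∀ y, ‖⟪y, T y⟫_ℂ‖ ≤ r * ‖y‖ ^ 2) (x : H) : ‖T x‖ ≤ 2 * r * ‖x‖ := by
  have hT' : ∀ y, ‖⟪T y, y⟫_ℂ‖ ≤ r * ‖y‖ ^ 2 := fun y => by
    rw [norm_inner_symm]; exact hT y
  have key : ∀ z y : H, ‖⟪T y, z⟫_ℂ‖ ≤ r * (‖z‖ ^ 2 + ‖y‖ ^ 2) := by
    intro z y
    rw [inner_map_polarization, norm_div]
    have p1 := parallelogram_law_with_norm ℂ z y
    have p2 := parallelogram_law_with_norm ℂ z (Complex.I • y)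
    rw [norm_smul, Complex.norm_I, one_mul] at p2
    have h1 := hT' (z + y)
    have h2 := hT' (z - y)
    have h3 := hT' (z + Complex.I • y)
    have h4 := hT' (z - Complex.I • y)
    have n4 : ‖(4 : ℂ)‖ = 4 := by simp
    rw [n4, div_le_iff₀ (by norm_num)]
    refine (norm_sub_le _ _).trans ?_
    refine (add_le_add_left ((norm_add_le _ _).trans
      (add_le_add_left (norm_sub_le _ _) _)) _).trans ?_
    simp only [norm_mul, Complex.norm_I, one_mul]
    calc _ ≤ r * ‖z + y‖ ^ 2 + r * ‖z - y‖ ^ 2 + r * ‖z + Complex.I • y‖ ^ 2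
          + r * ‖z - Complex.I • y‖ ^ 2 := by gcongr
      _ = r * ((‖z + y‖ ^ 2 + ‖z - y‖ ^ 2) +
          (‖z + Complex.I • y‖ ^ 2 + ‖z - Complex.I • y‖ ^ 2)) := by ring
      _ = _ := by rw [p1, p2]; ring
  rcases eq_or_ne (T x) 0 with h0 | h0
  · rw [h0, norm_zero]; positivity
  have hpos : 0 < ‖T x‖ := norm_pos_iff.2 h0
  rcases eq_or_ne x 0 with hx | hx
  · simp [hx]
  have hxpos : 0 < ‖x‖ := norm_pos_iff.2 hx
  have h := key (((‖x‖ / ‖T x‖ : ℝ) : ℂ) • T x) x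
  rw [inner_smul_right, inner_self_eq_norm_sq_to_K, norm_smul, norm_mul, Complex.norm_real,
    Real.norm_of_nonneg (by positivity), norm_pow] at h
  simp only [Complex.coe_algebraMap, Complex.norm_real, norm_norm] at h
  have e1 : ‖x‖ / ‖T x‖ * ‖T x‖ = ‖x‖ := by field_simp
  have e2 : ‖x‖ / ‖T x‖ * ‖T x‖ ^ 2 = ‖x‖ * ‖T x‖ := by field_simp
  rw [e1, e2] at h
  have : ‖x‖ * ‖T x‖ ≤ ‖x‖ * (2 * r * ‖x‖) := by linarith
  exact le_of_mul_le_mul_left this hxpos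

/-- The plane is a union of finitely many sectors on each of which `‖w‖ ≤ re (e * w)` for some
constant `e` with `‖e‖ ≤ 2`. -/
theorem exists_measurable_sector :
    ∃ (q : ℂ → ℕ) (e : ℕ → ℂ), Measurable q ∧ (∀ n, ‖e n‖ ≤ 2) ∧
      ∀ w, ‖w‖ ≤ (e (q w) * w).re := by
  refine ⟨fun w => if 0 ≤ w.re then (if 0 ≤ w.im then 0 else 1) else
      (if 0 ≤ w.im then 2 else 3), fun n => if n = 0 then ⟨1, -1⟩ else if n = 1 then ⟨1, 1⟩ else
      if n = 2 then ⟨-1, -1⟩ else ⟨-1, 1⟩, ?_, ?_, ?_⟩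
  · refine Measurable.ite (measurableSet_le measurable_const Complex.measurable_re) ?_ ?_ <;>
    exact Measurable.ite (measurableSet_le measurable_const Complex.measurable_im)
      measurable_const measurable_const
  · intro n
    refine (Complex.norm_le_abs_re_add_abs_im _).trans ?_
    dsimp only
    split_ifs <;> norm_num
  · intro w
    refine (Complex.norm_le_abs_re_add_abs_im _).trans ?_
    by_cases h1 : 0 ≤ w.re <;> by_cases h2 : 0 ≤ w.im <;>
      simp only [h1, h2, if_true, if_false, Complex.mul_re] <;>
      rcases abs_cases w.re with ⟨h3, h4⟩ | ⟨h3, h4⟩ <;>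
      rcases abs_cases w.im with ⟨h5, h6⟩ | ⟨h5, h6⟩ <;>
      first
        | exact absurd h4 h1
        | exact absurd h6 h2
        | (norm_num; linarith)

end Abstract

namespace ResolutionOfIdentity

variable {H : Type*} [NormedAddCommGroup H] [InnerProductSpace ℂ H] [CompleteSpace H]
  (E : ResolutionOfIdentity H)

theorem scalarMeasure_apply {s : Set ℂ} (hs : MeasurableSet s) (x : H) :
    E.scalarMeasure x s = ENNReal.ofReal (‖E.proj s x‖ ^ 2) :=
  Measure.ofMeasurable_apply s hs

theorem scalarMeasure_univ (x : H) : E.scalarMeasure x Set.univ = ENNReal.ofReal (‖x‖ ^ 2) := by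
  rw [E.scalarMeasure_apply .univ, E.univ, one_apply_eq_self]

instance isFiniteMeasure_scalarMeasure (x : H) : IsFiniteMeasure (E.scalarMeasure x) :=
  ⟨by rw [E.scalarMeasure_univ]; exact ENNReal.ofReal_lt_top⟩

theorem real_scalarMeasure_univ (x : H) : (E.scalarMeasure x).real Set.univ = ‖x‖ ^ 2 := by
  rw [Measure.real, E.scalarMeasure_univ, ENNReal.toReal_ofReal (by positivity)]

theorem scalarMeasure_eq_zero_iff {s : Set ℂ} (hs : MeasurableSet s) (x : H) :
    E.scalarMeasure x s = 0 ↔ E.proj s x = 0 := by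
  rw [E.scalarMeasure_apply hs, ENNReal.ofReal_eq_zero]
  constructor
  · intro h
    have : ‖E.proj s x‖ ^ 2 = 0 := le_antisymm h (by positivity)
    simpa using this
  · intro h; simp [h]

theorem proj_proj {s t : Set ℂ} (hs : MeasurableSet s) (ht : MeasurableSet t) (x : H) :
    E.proj s (E.proj t x) = E.proj (s ∩ t) x := by
  rw [E.inter s t hs ht, mul_apply_eq_comp]

theorem proj_idem {s : Set ℂ} (hs : MeasurableSet s) (x : H) :
    E.proj s (E.proj s x) = E.proj s x := by
  rw [E.proj_proj hs hs, inter_self]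

theorem inner_proj_left {s : Set ℂ} (hs : MeasurableSet s) (x y : H) :
    ⟪E.proj s x, y⟫_ℂ = ⟪x, E.proj s y⟫_ℂ := by
  have h2 : ContinuousLinearMap.adjoint (E.proj s) = E.proj s :=
    (E.isStarProjection s hs).isSelfAdjoint
  conv_rhs => rw [← h2]
  rw [ContinuousLinearMap.adjoint_inner_right]

theorem proj_comm {s t : Set ℂ} (hs : MeasurableSet s) (ht : MeasurableSet t) (x : H) :
    E.proj s (E.proj t x) = E.proj t (E.proj s x) := by
  rw [E.proj_proj hs ht, E.proj_proj ht hs, inter_comm]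

theorem proj_add_proj_compl {s : Set ℂ} (hs : MeasurableSet s) (x : H) :
    E.proj s x + E.proj sᶜ x = x := by
  have hm : ‖E.proj s x‖ ^ 2 + ‖E.proj sᶜ x‖ ^ 2 = ‖x‖ ^ 2 := by
    have h := measure_add_measure_compl (μ := E.scalarMeasure x) hs
    rw [E.scalarMeasure_univ, E.scalarMeasure_apply hs, E.scalarMeasure_apply hs.compl,
      ← ENNReal.ofReal_add (by positivity) (by positivity)] at h
    exact (ENNReal.ofReal_eq_ofReal_iff (by positivity) (by positivity)).1 h
  have h1 := E.inner_proj_self hs x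
  have h2 := E.inner_proj_self hs.compl x
  have h3 : ⟪E.proj s x, E.proj sᶜ x⟫_ℂ = 0 := by
    rw [E.inner_proj_left hs, E.proj_proj hs hs.compl, inter_compl_self, E.empty]; simp
  have h4 : ⟪E.proj sᶜ x, E.proj s x⟫_ℂ = 0 := by rw [← inner_conj_symm, h3, map_zero]
  have h5 : ⟪E.proj s x, x⟫_ℂ = ((‖E.proj s x‖ ^ 2 : ℝ) : ℂ) := by rw [E.inner_proj_left hs, h1]
  have h6 : ⟪E.proj sᶜ x, x⟫_ℂ = ((‖E.proj sᶜ x‖ ^ 2 : ℝ) : ℂ) := by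
    rw [E.inner_proj_left hs.compl, h2]
  rw [← sub_eq_zero, ← inner_self_eq_zero (𝕜 := ℂ)]
  simp only [inner_sub_left, inner_sub_right, inner_add_left, inner_add_right, h1, h2, h3, h4, h5,
    h6]
  simp only [inner_self_eq_norm_sq_to_K, Complex.coe_algebraMap, ← Complex.ofReal_pow, ← hm]
  push_cast
  ring

theorem scalarMeasure_proj {s : Set ℂ} (hs : MeasurableSet s) (x : H) :
    E.scalarMeasure (E.proj s x) = (E.scalarMeasure x).restrict s := by
  ext t ht
  rw [Measure.restrict_apply ht, E.scalarMeasure_apply ht, E.scalarMeasure_apply (ht.inter hs),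
    E.proj_proj ht hs]

theorem scalarMeasure_add_of_orthogonal {s : Set ℂ} (hs : MeasurableSet s) {x y : H}
    (hx : E.proj s x = x) (hy : E.proj s y = 0) :
    E.scalarMeasure (x + y) = E.scalarMeasure x + E.scalarMeasure y := by
  ext t ht
  rw [Measure.add_apply, E.scalarMeasure_apply ht, E.scalarMeasure_apply ht,
    E.scalarMeasure_apply ht, ← ENNReal.ofReal_add (by positivity) (by positivity), map_add]
  congr 1
  have h : ⟪E.proj t x, E.proj t y⟫_ℂ = 0 := by
    rw [E.inner_proj_left ht, E.proj_idem ht, ← hx, E.inner_proj_left hs, E.proj_comm hs ht, hy]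
    simp
  have := norm_add_sq_eq_norm_sq_add_norm_sq_of_inner_eq_zero _ _ h
  simpa [sq] using this

theorem scalarMeasure_smul_of_norm_eq_one {a : ℂ} (ha : ‖a‖ = 1) (x : H) :
    E.scalarMeasure (a • x) = E.scalarMeasure x := by
  ext t ht
  rw [E.scalarMeasure_apply ht, E.scalarMeasure_apply ht, map_smul, norm_smul, ha, one_mul]

theorem ofReal_norm_sq_eq_tsum {q : ℂ → ℕ} (hq : Measurable q) (y : H) :
    ENNReal.ofReal (‖y‖ ^ 2) = ∑' n, ENNReal.ofReal (‖E.proj (q ⁻¹' {n}) y‖ ^ 2) := by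
  have h := E.enorm_sq_iUnion y (fun n => q ⁻¹' {n}) (fun n => hq (measurableSet_singleton n))
    (fun m n hmn => Disjoint.preimage q (by simpa using hmn))
  have hU : (⋃ n, q ⁻¹' {n}) = Set.univ := by ext z; simp
  rwa [hU, E.univ, one_apply_eq_self] at h

theorem eq_zero_of_proj_eq_zero {s : ℕ → Set ℂ} (hs : ∀ n, MeasurableSet (s n))
    (hU : ⋃ n, s n = Set.univ) {x : H} (hx : ∀ n, E.proj (s n) x = 0) : x = 0 := by
  have h : E.scalarMeasure x (⋃ n, s n) = 0 :=
    measure_iUnion_null fun n => (E.scalarMeasure_eq_zero_iff (hs n) x).2 (hx n)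
  rw [hU, E.scalarMeasure_eq_zero_iff .univ, E.univ] at h
  simpa using h

/-- The push-forward of a resolution of the identity under a measurable map. -/
noncomputable def map (h : ℂ → ℂ) (hh : Measurable h) : ResolutionOfIdentity H where
  proj s := E.proj (h ⁻¹' s)
  isStarProjection s hs := E.isStarProjection _ (hh hs)
  empty := by simp [E.empty]
  univ := by simp [E.univ]
  inter s t hs ht := by rw [preimage_inter, E.inter _ _ (hh hs) (hh ht)]
  iUnion s hs hd x := by
    rw [preimage_iUnion]
    exact E.iUnion _ (fun n => hh (hs n)) (fun m n hmn => (hd hmn).preimage h) x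

theorem scalarMeasure_map {h : ℂ → ℂ} (hh : Measurable h) (x : H) :
    (E.map h hh).scalarMeasure x = (E.scalarMeasure x).map h := by
  ext s hs
  rw [Measure.map_apply hh hs, scalarMeasure_apply _ hs, E.scalarMeasure_apply (hh hs)]
  rfl

end ResolutionOfIdentity

namespace ResolutionOfIdentity

variable {H : Type*} [NormedAddCommGroup H] [InnerProductSpace ℂ H] [CompleteSpace H]
  {E : ResolutionOfIdentity H} {f : ℂ → ℂ} {A : H →ₗ.[ℂ] H}

namespace IsIntegral

theorem integrable (hA : E.IsIntegral f A) (hf : Measurable f) {x : H} (hx : x ∈ A.domain) :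
    Integrable f (E.scalarMeasure x) := by
  have h2 : MemLp f 2 (E.scalarMeasure x) := by
    refine ⟨hf.aestronglyMeasurable, ?_⟩
    rw [eLpNorm_lt_top_iff_lintegral_rpow_enorm_lt_top two_ne_zero ENNReal.ofNat_ne_top]
    simpa using (hA.1 x).1 hx
  exact h2.integrable one_le_two

theorem proj_mem_domain (hA : E.IsIntegral f A) {s : Set ℂ} (hs : MeasurableSet s) {x : H}
    (hx : x ∈ A.domain) : E.proj s x ∈ A.domain := by
  rw [hA.1, E.scalarMeasure_proj hs]
  exact (setLIntegral_le_lintegral _ _).trans_lt ((hA.1 x).1 hx)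

theorem proj_mem_domain_of_bounded (hA : E.IsIntegral f A) {s : Set ℂ} (hs : MeasurableSet s)
    {M : ℝ} (hM : ∀ z ∈ s, ‖f z‖ ≤ M) (x : H) : E.proj s x ∈ A.domain := by
  rw [hA.1, E.scalarMeasure_proj hs]
  calc ∫⁻ z in s, ‖f z‖ₑ ^ 2 ∂(E.scalarMeasure x)
      ≤ ∫⁻ _ in s, ENNReal.ofReal M ^ 2 ∂(E.scalarMeasure x) := by
        refine setLIntegral_mono' hs fun z hz => ?_
        gcongr
        rw [← ofReal_norm]
        exact ENNReal.ofReal_le_ofReal (hM z hz)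
    _ < ∞ := by
        rw [setLIntegral_const]
        exact ENNReal.mul_lt_top (by simp) (measure_lt_top _ _)

theorem inner_sub_smul (hA : E.IsIntegral f A) (hf : Measurable f) (l : ℂ) (x : A.domain) :
    ⟪(x : H), A x - l • (x : H)⟫_ℂ = ∫ z, (f z - l) ∂(E.scalarMeasure (x : H)) := by
  rw [inner_sub_right, hA.2, inner_smul_right, integral_sub (hA.integrable hf x.2)
    (integrable_const _), integral_const, E.real_scalarMeasure_univ, inner_self_eq_norm_sq_to_K,
    Complex.real_smul, mul_comm l]
  simp

theorem inner_map_eq_zero_of_orthogonal (hA : E.IsIntegral f A) (hf : Measurable f) {s : Set ℂ}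
    (hs : MeasurableSet s) (x y : A.domain) (hx : E.proj s (x : H) = x)
    (hy : E.proj s (y : H) = 0) : ⟪(x : H), A y⟫_ℂ = 0 := by
  have key : ∀ a : ℂ, ‖a‖ = 1 →
      a * ⟪(x : H), A y⟫_ℂ + (starRingEnd ℂ) a * ⟪(y : H), A x⟫_ℂ = 0 := by
    intro a ha
    have hay : E.proj s (a • (y : H)) = 0 := by rw [map_smul, hy, smul_zero]
    have h := hA.2 (x + a • y)
    have hm : E.scalarMeasure ((x + a • y : A.domain) : H) =
        E.scalarMeasure (x : H) + E.scalarMeasure (y : H) := by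
      rw [Submodule.coe_add, Submodule.coe_smul, E.scalarMeasure_add_of_orthogonal hs hx hay,
        E.scalarMeasure_smul_of_norm_eq_one ha]
    rw [hm, integral_add_measure (hA.integrable hf x.2) (hA.integrable hf y.2), ← hA.2, ← hA.2,
      A.map_add, A.map_smul, Submodule.coe_add, Submodule.coe_smul, inner_add_left,
      inner_add_right, inner_add_right, inner_smul_left, inner_smul_left, inner_smul_right,
      inner_smul_right] at h
    have haa : (starRingEnd ℂ) a * a = 1 := by
      rw [mul_comm, Complex.mul_conj, Complex.normSq_eq_norm_sq, ha]; simp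
    linear_combination h - ⟪(y : H), A y⟫_ℂ * haa
  have h1 := key 1 (by simp)
  have h2 := key Complex.I (by simp)
  simp only [map_one, one_mul, Complex.conj_I] at h1 h2
  have h3 : Complex.I * (⟪(x : H), A y⟫_ℂ - ⟪(y : H), A x⟫_ℂ) = 0 := by linear_combination h2
  have h4 := (mul_eq_zero.1 h3).resolve_left Complex.I_ne_zero
  linear_combination (h1 + h4) / 2

theorem proj_compl_map_proj (hA : E.IsIntegral f A) (hf : Measurable f) {s : Set ℂ}
    (hs : MeasurableSet s) (x : A.domain) :
    E.proj sᶜ (A ⟨E.proj s x, hA.proj_mem_domain hs x.2⟩) = 0 := by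
  set w := E.proj sᶜ (A ⟨E.proj s x, hA.proj_mem_domain hs x.2⟩) with hw
  have hmeas : ∀ n : ℕ, MeasurableSet {z | ‖f z‖ ≤ (n : ℝ)} := fun n =>
    measurableSet_le hf.norm measurable_const
  refine E.eq_zero_of_proj_eq_zero (s := fun n : ℕ => {z | ‖f z‖ ≤ (n : ℝ)}) hmeas ?_ fun n => ?_
  · ext z
    simpa using exists_nat_ge ‖f z‖
  · have hd : E.proj {z | ‖f z‖ ≤ (n : ℝ)} w ∈ A.domain :=
      hA.proj_mem_domain_of_bounded (hmeas n) (fun z hz => hz) w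
    have hc : E.proj sᶜ (E.proj {z | ‖f z‖ ≤ (n : ℝ)} w) = E.proj {z | ‖f z‖ ≤ (n : ℝ)} w := by
      rw [E.proj_comm hs.compl (hmeas n), hw, E.proj_idem hs.compl]
    have h := hA.inner_map_eq_zero_of_orthogonal hf hs.compl
      ⟨E.proj {z | ‖f z‖ ≤ (n : ℝ)} w, hd⟩ ⟨E.proj s x, hA.proj_mem_domain hs x.2⟩ hc
      (by rw [E.proj_proj hs.compl hs, compl_inter_self, E.empty]; simp)
    simp only at h
    rw [← hc, E.inner_proj_left hs.compl, ← hw, E.inner_proj_left (hmeas n), E.inner_proj_self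
      (hmeas n)] at h
    simpa using h

/-- The operator `∫ f dE` commutes with the projections of `E`. -/
theorem map_proj (hA : E.IsIntegral f A) (hf : Measurable f) {s : Set ℂ}
    (hs : MeasurableSet s) (x : A.domain) :
    A ⟨E.proj s x, hA.proj_mem_domain hs x.2⟩ = E.proj s (A x) := by
  have h1 := hA.proj_compl_map_proj hf hs x
  have h2 := hA.proj_compl_map_proj hf hs.compl x
  simp only [compl_compl] at h2
  have hx : x = ⟨E.proj s x, hA.proj_mem_domain hs x.2⟩ +
      ⟨E.proj sᶜ x, hA.proj_mem_domain hs.compl x.2⟩ :=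
    Subtype.ext (E.proj_add_proj_compl hs (x : H)).symm
  have h3 : A x = A ⟨E.proj s x, hA.proj_mem_domain hs x.2⟩ +
      A ⟨E.proj sᶜ x, hA.proj_mem_domain hs.compl x.2⟩ := by
    conv_lhs => rw [hx]
    rw [A.map_add]
  rw [h3, map_add, h2, add_zero]
  conv_lhs => rw [← E.proj_add_proj_compl hs (A ⟨E.proj s x, hA.proj_mem_domain hs x.2⟩), h1,
    add_zero]

/-- On the range of `E(s)`, the operator `∫ f dE` is close to `l` if `f` is close to `l` on `s`. -/
theorem norm_map_proj_sub_smul_le (hA : E.IsIntegral f A) (hf : Measurable f) {s : Set ℂ}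
    (hs : MeasurableSet s) {l : ℂ} {r : ℝ} (hr : 0 ≤ r) (hl : ∀ z ∈ s, ‖f z - l‖ ≤ r) (x : H)
    (hx : E.proj s x ∈ A.domain) :
    ‖A ⟨E.proj s x, hx⟩ - l • E.proj s x‖ ≤ 2 * r * ‖x‖ := by
  have hd : ∀ y, E.proj s y ∈ A.domain := fun y =>
    hA.proj_mem_domain_of_bounded hs (M := r + ‖l‖) (fun z hz => by
      have := norm_add_le (f z - l) l
      rw [sub_add_cancel] at this
      linarith [hl z hz]) y
  let T : H →ₗ[ℂ] H :=
    A.toFun.comp ((E.proj s).toLinearMap.codRestrict A.domain hd) - l • (E.proj s).toLinearMap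
  have hT : ∀ y, T y = A ⟨E.proj s y, hd y⟩ - l • E.proj s y := fun y => rfl
  rw [← hT x]
  refine norm_map_le_of_numericalRadius_le T hr (fun y => ?_) x
  have e1 : T y = E.proj s (T y) := by
    have h := hA.map_proj hf hs ⟨E.proj s y, hd y⟩
    simp only [E.proj_idem hs] at h
    rw [hT, map_sub, map_smul, E.proj_idem hs, ← h]
  have e2 : ⟪y, T y⟫_ℂ = ∫ z in s, (f z - l) ∂(E.scalarMeasure y) := by
    rw [e1, ← E.inner_proj_left hs, hT, ← E.scalarMeasure_proj hs]
    exact hA.inner_sub_smul hf l ⟨E.proj s y, hd y⟩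
  rw [e2]
  refine (norm_setIntegral_le_of_norm_le_const (measure_lt_top _ _) hl).trans ?_
  gcongr
  rw [← E.real_scalarMeasure_univ]
  exact measureReal_mono (subset_univ s)

/-- If `re (e * (f - l)) ≥ d` on `s`, then `∫ f dE - l` is bounded below on the range of `E(s)`. -/
theorem mul_norm_sq_le_of_sector (hA : E.IsIntegral f A) (hf : Measurable f) {s : Set ℂ}
    (hs : MeasurableSet s) {l e : ℂ} {d : ℝ} (he : ‖e‖ ≤ 2) (x : A.domain)
    (hx : E.proj s (x : H) = x)
    (hl : ∀ᵐ z ∂(E.scalarMeasure (x : H)), z ∈ s → d ≤ (e * (f z - l)).re) :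
    d / 2 * ‖(x : H)‖ ^ 2 ≤ ‖⟪(x : H), A x - l • (x : H)⟫_ℂ‖ := by
  have hμ : E.scalarMeasure (x : H) = (E.scalarMeasure (x : H)).restrict s := by
    conv_lhs => rw [← hx]
    exact E.scalarMeasure_proj hs _
  have hmem : ∀ᵐ z ∂(E.scalarMeasure (x : H)), z ∈ s := by
    rw [hμ]; exact ae_restrict_mem hs
  have hint : Integrable (fun z => e * (f z - l)) (E.scalarMeasure (x : H)) :=
    ((hA.integrable hf x.2).sub (integrable_const _)).const_mul e
  have h1 : d * ‖(x : H)‖ ^ 2 ≤ (e * ⟪(x : H), A x - l • (x : H)⟫_ℂ).re := by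
    rw [hA.inner_sub_smul hf, ← integral_const_mul]
    change _ ≤ Complex.reCLM _
    rw [← Complex.reCLM.integral_comp_comm hint]
    calc d * ‖(x : H)‖ ^ 2 = ∫ _, d ∂(E.scalarMeasure (x : H)) := by
          rw [integral_const, E.real_scalarMeasure_univ, smul_eq_mul, mul_comm]
      _ ≤ _ := by
          refine integral_mono_ae (integrable_const _) hint.re ?_
          filter_upwards [hl, hmem] with z h1 h2 using h1 h2
  have h2 := h1.trans (Complex.re_le_norm _)
  rw [norm_mul] at h2
  have h3 := mul_le_mul_of_nonneg_right he (norm_nonneg ⟪(x : H), A x - l • (x : H)⟫_ℂ)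
  linarith

/-- If `|f - l| ≥ d` almost everywhere, then `∫ f dE - l` is bounded below. -/
theorem mul_norm_le_norm_map_sub_smul (hA : E.IsIntegral f A) (hf : Measurable f) {l : ℂ} {d : ℝ}
    (hd : 0 ≤ d) (x : A.domain) (hl : ∀ᵐ z ∂(E.scalarMeasure (x : H)), d ≤ ‖f z - l‖) :
    d / 2 * ‖(x : H)‖ ≤ ‖A x - l • (x : H)‖ := by
  obtain ⟨q, e, hq, he, hqe⟩ := exists_measurable_sector
  have hp : Measurable fun z => q (f z - l) := hq.comp (hf.sub_const l)
  have hs : ∀ n, MeasurableSet ((fun z => q (f z - l)) ⁻¹' {n}) := fun n =>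
    hp (measurableSet_singleton n)
  have key : ∀ n, d / 2 * ‖E.proj ((fun z => q (f z - l)) ⁻¹' {n}) x‖ ≤
      ‖E.proj ((fun z => q (f z - l)) ⁻¹' {n}) (A x - l • (x : H))‖ := by
    intro n
    set s := (fun z => q (f z - l)) ⁻¹' {n}
    have h := hA.mul_norm_sq_le_of_sector hf (hs n) (l := l) (d := d) (he n)
      ⟨E.proj s x, hA.proj_mem_domain (hs n) x.2⟩ (E.proj_idem (hs n) _) (by
        rw [E.scalarMeasure_proj (hs n)]
        filter_upwards [ae_restrict_of_ae hl] with z h1 h2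
        have h3 : q (f z - l) = n := h2
        rw [← h3]
        exact h1.trans (hqe _))
    have e1 : A ⟨E.proj s x, hA.proj_mem_domain (hs n) x.2⟩ - l • E.proj s x =
        E.proj s (A x - l • (x : H)) := by
      rw [hA.map_proj hf (hs n), map_sub, map_smul]
    simp only at h
    rw [e1] at h
    have h4 := h.trans (norm_inner_le_norm _ _)
    rcases (norm_nonneg (E.proj s x)).eq_or_lt with h0 | h0
    · rw [← h0, mul_zero]; exact norm_nonneg _
    · refine le_of_mul_le_mul_left ?_ h0
      linarith
  have h := E.ofReal_norm_sq_eq_tsum hp (A x - l • (x : H))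
  have h' := E.ofReal_norm_sq_eq_tsum hp (((d / 2 : ℝ) : ℂ) • (x : H))
  have hle : ENNReal.ofReal (‖((d / 2 : ℝ) : ℂ) • (x : H)‖ ^ 2) ≤
      ENNReal.ofReal (‖A x - l • (x : H)‖ ^ 2) := by
    rw [h, h']
    refine ENNReal.tsum_le_tsum fun n => ENNReal.ofReal_le_ofReal ?_
    rw [map_smul, norm_smul, Complex.norm_real, Real.norm_of_nonneg (by positivity)]
    exact pow_le_pow_left₀ (by positivity) (key n) 2
  rw [ENNReal.ofReal_le_ofReal_iff (by positivity)] at hle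
  have := (pow_le_pow_iff_left₀ (norm_nonneg _) (norm_nonneg _) two_ne_zero).1 hle
  rwa [norm_smul, Complex.norm_real, Real.norm_of_nonneg (by positivity)] at this

/-- Two resolutions of the identity that represent the same operator have the same support. -/
theorem proj_ball_ne_zero {E₁ E₂ : ResolutionOfIdentity H} (h₁ : E₁.IsIntegral (fun z => z) A)
    (h₂ : E₂.IsIntegral (fun z => z) A) {l : ℂ}
    (h : ∀ r : ℝ, 0 < r → E₁.proj (Metric.ball l r) ≠ 0) {r : ℝ} (hr : 0 < r) :
    E₂.proj (Metric.ball l r) ≠ 0 := by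
  intro h0
  have hr8 : 0 < r / 8 := by positivity
  obtain ⟨x, hx⟩ : ∃ x, E₁.proj (Metric.ball l (r / 8)) x ≠ 0 := by
    by_contra! hc
    exact h _ hr8 (ContinuousLinearMap.ext hc)
  set y := E₁.proj (Metric.ball l (r / 8)) x with hy
  have hball : ∀ z ∈ Metric.ball l (r / 8), ‖z - l‖ ≤ r / 8 := fun z hz => by
    rw [← dist_eq_norm]; exact (Metric.mem_ball.1 hz).le
  have hyd : y ∈ A.domain := h₁.proj_mem_domain_of_bounded measurableSet_ball
    (M := r / 8 + ‖l‖) (fun z hz => by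
      have := norm_add_le (z - l) l
      rw [sub_add_cancel] at this
      linarith [hball z hz]) x
  have hyy : E₁.proj (Metric.ball l (r / 8)) y = y := E₁.proj_idem measurableSet_ball x
  have u := h₁.norm_map_proj_sub_smul_le measurable_id measurableSet_ball hr8.le hball y
    (by rwa [hyy])
  have v := h₂.mul_norm_le_norm_map_sub_smul measurable_id (l := l) hr.le ⟨y, hyd⟩ (by
    have : E₂.scalarMeasure y (Metric.ball l r) = 0 := by
      rw [E₂.scalarMeasure_eq_zero_iff measurableSet_ball, h0]; simp
    refine measure_mono_null (fun z hz => ?_) this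
    simpa [dist_eq_norm] using hz)
  simp only [hyy] at u v
  have hpos : 0 < ‖y‖ := norm_pos_iff.2 hx
  nlinarith [u, v, mul_pos hr hpos]

end IsIntegral

/-- The complement of the support of `E` is `E`-null. -/
theorem proj_compl_eq_zero (E : ResolutionOfIdentity H) {K : Set ℂ} (hK : MeasurableSet K)
    (h : ∀ l ∉ K, ∃ r : ℝ, 0 < r ∧ E.proj (Metric.ball l r) = 0) : E.proj Kᶜ = 0 := by
  ext x
  rw [zero_apply, ← E.scalarMeasure_eq_zero_iff hK.compl]
  refine measure_null_of_locally_null _ fun l hl => ?_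
  obtain ⟨r, hr, h0⟩ := h l hl
  refine ⟨Metric.ball l r, mem_nhdsWithin_of_mem_nhds (Metric.ball_mem_nhds l hr), ?_⟩
  rw [E.scalarMeasure_eq_zero_iff measurableSet_ball, h0]; simp

theorem ae_mem_of_proj_compl_eq_zero (E : ResolutionOfIdentity H) {K : Set ℂ}
    (hK : MeasurableSet K) (h : E.proj Kᶜ = 0) (x : H) : ∀ᵐ z ∂(E.scalarMeasure x), z ∈ K := by
  have : E.scalarMeasure x Kᶜ = 0 := by
    rw [E.scalarMeasure_eq_zero_iff hK.compl, h]; simp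
  exact this

namespace IsIntegral

theorem exists_proj_norm_lt_eq_zero_of_isInvertible (hA : E.IsIntegral f A) (hf : Measurable f)
    (hi : IsInvertible A) : ∃ d : ℝ, 0 < d ∧ E.proj {z | ‖f z‖ < d} = 0 := by
  obtain ⟨B, -, -, hB⟩ := hi
  have hpos : 0 < 4 * (‖B‖ + 1) := by positivity
  refine ⟨1 / (4 * (‖B‖ + 1)), by positivity, ?_⟩
  set d := 1 / (4 * (‖B‖ + 1))
  have hd : 0 < d := by positivity
  have hs : MeasurableSet {z | ‖f z‖ < d} := measurableSet_lt hf.norm measurable_const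
  ext x
  set y := E.proj {z | ‖f z‖ < d} x with hy
  have hyd : y ∈ A.domain := hA.proj_mem_domain_of_bounded hs (fun z hz => le_of_lt hz) x
  have hyy : E.proj {z | ‖f z‖ < d} y = y := E.proj_idem hs x
  have u := hA.norm_map_proj_sub_smul_le hf hs (l := 0) hd.le
    (fun z hz => by rw [sub_zero]; exact le_of_lt hz) y (by rwa [hyy])
  simp only [hyy, zero_smul, sub_zero] at u
  have h1 : ‖y‖ ≤ ‖B‖ * ‖A ⟨y, hyd⟩‖ := by
    calc ‖y‖ = ‖B (A ⟨y, hyd⟩)‖ := by rw [hB]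
      _ ≤ _ := B.le_opNorm _
  have h2 : ‖B‖ * ‖A ⟨y, hyd⟩‖ ≤ ‖B‖ * (2 * d * ‖y‖) := by gcongr
  have h3 : ‖B‖ * (2 * d) ≤ 1 / 2 := by
    have : (‖B‖ + 1) * (4 * d) = 1 := by simp only [d]; field_simp
    linarith
  have h4 : ‖B‖ * (2 * d) * ‖y‖ ≤ 1 / 2 * ‖y‖ := by gcongr
  have h5 : ‖y‖ ≤ 0 := by linarith
  simpa using h5

theorem isInvertible (hA : E.IsIntegral f A) (hf : Measurable f) {S : Set ℂ}
    (hS : MeasurableSet S) (hES : E.proj Sᶜ = 0) {d M : ℝ} (hd : 0 < d)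
    (hdf : ∀ z ∈ S, d ≤ ‖f z‖) (hfM : ∀ z ∈ S, ‖f z‖ ≤ M) : IsInvertible A := by
  have hproj : ∀ x, E.proj S x = x := fun x => by
    have := E.proj_add_proj_compl hS x
    rwa [hES, zero_apply, add_zero] at this
  have hdom : ∀ x, x ∈ A.domain := fun x => by
    rw [← hproj x]; exact hA.proj_mem_domain_of_bounded hS hfM x
  have hlow : ∀ x, d / 2 * ‖x‖ ≤ ‖A ⟨x, hdom x⟩‖ := fun x => by
    have := hA.mul_norm_le_norm_map_sub_smul hf (l := 0) hd.le ⟨x, hdom x⟩ (by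
      filter_upwards [E.ae_mem_of_proj_compl_eq_zero hS hES x] with z hz
      rw [sub_zero]; exact hdf z hz)
    simpa using this
  have hup : ∀ x, ‖A ⟨x, hdom x⟩‖ ≤ 2 * |M| * ‖x‖ := fun x => by
    have := hA.norm_map_proj_sub_smul_le hf hS (l := 0) (abs_nonneg M)
      (fun z hz => by rw [sub_zero]; exact (hfM z hz).trans (le_abs_self M)) x (hdom _)
    simpa [hproj] using this
  let T₀ : H →ₗ[ℂ] H := A.toFun.comp (LinearMap.codRestrict A.domain LinearMap.id hdom)
  let T : H →L[ℂ] H := T₀.mkContinuous (2 * |M|) hup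
  have hT : ∀ x, T x = A ⟨x, hdom x⟩ := fun x => rfl
  have hanti : AntilipschitzWith (Real.toNNReal (2 / d)) T := by
    refine AddMonoidHomClass.antilipschitz_of_bound T fun x => ?_
    rw [Real.coe_toNNReal _ (by positivity)]
    have := hlow x
    rw [hT]
    calc ‖x‖ = 2 / d * (d / 2 * ‖x‖) := by field_simp
      _ ≤ _ := by gcongr
  have hclosed : IsClosed (T.range : Set H) := by
    exact hanti.isClosed_range T.uniformContinuous
  have hperp : T.rangeᗮ = ⊥ := by
    rw [Submodule.eq_bot_iff]
    intro y hy
    obtain ⟨q, e, hq, he, hqe⟩ := exists_measurable_sector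
    have hp : Measurable fun z => q (f z) := hq.comp hf
    have hs : ∀ n, MeasurableSet ((fun z => q (f z)) ⁻¹' {n}) := fun n =>
      hp (measurableSet_singleton n)
    refine E.eq_zero_of_proj_eq_zero hs (by ext z; simp) fun n => ?_
    set s := (fun z => q (f z)) ⁻¹' {n}
    have h := hA.mul_norm_sq_le_of_sector hf (hs n) (l := 0) (d := d) (he n)
      ⟨E.proj s y, hdom _⟩ (E.proj_idem (hs n) _) (by
        filter_upwards [E.ae_mem_of_proj_compl_eq_zero hS hES (E.proj s y)] with z h1 h2
        have h3 : q (f z) = n := h2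
        rw [sub_zero, ← h3]
        exact (hdf z h1).trans (hqe _))
    have h0 : ⟪E.proj s y, A ⟨E.proj s y, hdom _⟩⟫_ℂ = 0 := by
      have := hA.map_proj hf (hs n) ⟨E.proj s y, hdom _⟩
      rw [E.inner_proj_left (hs n), ← this, ← hT]
      exact Submodule.inner_left_of_mem_orthogonal (LinearMap.mem_range_self _ _) hy
    simp only [zero_smul, sub_zero, h0, norm_zero] at h
    have h5 : ‖E.proj s y‖ ^ 2 ≤ 0 := by
      by_contra! hc
      nlinarith
    simpa using le_antisymm h5 (by positivity)
  have hsurj : T.range = ⊤ := by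
    have : CompleteSpace T.range := hclosed.completeSpace_coe
    rw [← Submodule.orthogonal_eq_bot_iff]
    exact hperp
  have hinj : T.ker = ⊥ := LinearMap.ker_eq_bot.2 hanti.injective
  let e := ContinuousLinearEquiv.ofBijective T hinj hsurj
  refine ⟨e.symm, ?_, fun u hu => ?_, fun v => ?_⟩
  · rw [(Submodule.eq_top_iff'.2 hdom : A.domain = ⊤)]
    exact e.symm.surjective.range_eq
  · exact ContinuousLinearEquiv.ofBijective_apply_symm_apply T hinj hsurj u
  · exact ContinuousLinearEquiv.ofBijective_symm_apply_apply T hinj hsurj (v : H)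

end IsIntegral

end ResolutionOfIdentity

section WeakLimit

open Filter Topology

variable {H : Type*} [NormedAddCommGroup H] [InnerProductSpace ℂ H] [CompleteSpace H]

/-- A bounded sequence of operators whose quadratic forms converge has a weak limit. -/
theorem exists_clm_of_tendsto_inner (T : ℕ → H →L[ℂ] H) {C : ℝ}
    (hb : ∀ n y, ‖T n y‖ ≤ C * ‖y‖) {Q : H → ℂ}
    (hQ : ∀ x, Tendsto (fun n => ⟪T n x, x⟫_ℂ) atTop (𝓝 (Q x))) :
    ∃ A : H →L[ℂ] H, ∀ x, ⟪A x, x⟫_ℂ = Q x := by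
  have hex : ∀ x y, ∃ l, Tendsto (fun n => ⟪T n x, y⟫_ℂ) atTop (𝓝 l) := by
    intro x y
    refine ⟨_, Tendsto.congr (fun n => (inner_map_polarization' (T n).toLinearMap x y).symm)
      (((((hQ (x + y)).sub (hQ (x - y))).sub ((hQ (x + Complex.I • y)).const_mul Complex.I)).add
        ((hQ (x - Complex.I • y)).const_mul Complex.I)).div_const 4)⟩
  choose L hL using hex
  let B₀ : H →ₛₗ[starRingEnd ℂ] H →ₗ[ℂ] ℂ := LinearMap.mk₂'ₛₗ (starRingEnd ℂ) (RingHom.id ℂ) L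
    (fun x x' y => tendsto_nhds_unique (hL _ _)
      (((hL x y).add (hL x' y)).congr fun n => by rw [map_add, inner_add_left]))
    (fun a x y => tendsto_nhds_unique (hL _ _)
      (((hL x y).const_mul _).congr fun n => by rw [map_smul, inner_smul_left]))
    (fun x y y' => tendsto_nhds_unique (hL _ _)
      (((hL x y).add (hL x y')).congr fun n => by rw [inner_add_right]))
    (fun a x y => tendsto_nhds_unique (hL _ _)
      (((hL x y).const_mul _).congr fun n => by rw [inner_smul_right]; rfl))
  let B : H →L⋆[ℂ] H →L[ℂ] ℂ := B₀.mkContinuous₂ C fun x y => by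
    refine le_of_tendsto (hL x y).norm (Eventually.of_forall fun n => ?_)
    exact (norm_inner_le_norm _ _).trans (by gcongr; exact hb n x)
  refine ⟨InnerProductSpace.continuousLinearMapOfBilin B, fun x => ?_⟩
  rw [InnerProductSpace.continuousLinearMapOfBilin_apply]
  exact tendsto_nhds_unique (hL x x) (hQ x)

end WeakLimit

namespace ResolutionOfIdentity

open Filter Topology

variable {H : Type*} [NormedAddCommGroup H] [InnerProductSpace ℂ H] [CompleteSpace H]
  {E : ResolutionOfIdentity H}

/-- The integral of a simple function. -/
noncomputable def simpleIntegral (E : ResolutionOfIdentity H) (g : SimpleFunc ℂ ℂ) : H →L[ℂ] H :=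
  ∑ a ∈ g.range, a • E.proj (g ⁻¹' {a})

theorem inner_simpleIntegral (g : SimpleFunc ℂ ℂ) (x : H) :
    ⟪x, E.simpleIntegral g x⟫_ℂ = ∫ z, g z ∂(E.scalarMeasure x) := by
  rw [← SimpleFunc.integral_eq_integral _ (SimpleFunc.integrable_of_isFiniteMeasure g),
    SimpleFunc.integral_eq, simpleIntegral, sum_apply, inner_sum]
  refine Finset.sum_congr rfl fun a _ => ?_
  rw [smul_apply, inner_smul_right,
    E.inner_proj_self (g.measurableSet_fiber a), Measure.real,
    E.scalarMeasure_apply (g.measurableSet_fiber a), ENNReal.toReal_ofReal (by positivity),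
    Complex.real_smul, mul_comm]

theorem norm_integral_scalarMeasure_le {g : ℂ → ℂ} {M : ℝ} (hM : ∀ z, ‖g z‖ ≤ M) (x : H) :
    ‖∫ z, g z ∂(E.scalarMeasure x)‖ ≤ M * ‖x‖ ^ 2 := by
  rw [← E.real_scalarMeasure_univ x]
  exact norm_integral_le_of_norm_le_const (Eventually.of_forall hM)

/-- The integral of a bounded measurable function exists. -/
theorem exists_isIntegral_of_bounded (E : ResolutionOfIdentity H) {g : ℂ → ℂ} (hg : Measurable g)
    {M : ℝ} (hM : ∀ z, ‖g z‖ ≤ M) : ∃ A : H →ₗ.[ℂ] H, E.IsIntegral g A := by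
  have hM0 : 0 ≤ M := (norm_nonneg _).trans (hM 0)
  let G := hg.stronglyMeasurable.approxBounded M
  have hG : ∀ n z, ‖G n z‖ ≤ M := hg.stronglyMeasurable.norm_approxBounded_le hM0
  have hlim : ∀ z, Tendsto (fun n => G n z) atTop (𝓝 (g z)) := fun z =>
    hg.stronglyMeasurable.tendsto_approxBounded_of_norm_le (hM z)
  have hQ : ∀ x, Tendsto (fun n => ⟪x, E.simpleIntegral (G n) x⟫_ℂ) atTop
      (𝓝 (∫ z, g z ∂(E.scalarMeasure x))) := by
    intro x
    simp only [inner_simpleIntegral]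
    exact tendsto_integral_of_dominated_convergence (fun _ => M)
      (fun n => (G n).stronglyMeasurable.aestronglyMeasurable) (integrable_const M)
      (fun n => Eventually.of_forall (hG n)) (Eventually.of_forall hlim)
  obtain ⟨A, hA⟩ := exists_clm_of_tendsto_inner (fun n => E.simpleIntegral (G n)) (C := 2 * M)
    (Q := fun x => (starRingEnd ℂ) (∫ z, g z ∂(E.scalarMeasure x)))
    (fun n y => norm_map_le_of_numericalRadius_le (E.simpleIntegral (G n)).toLinearMap hM0
      (fun x => by
        rw [ContinuousLinearMap.coe_coe, inner_simpleIntegral]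
        exact norm_integral_scalarMeasure_le (hG n) x) y)
    (fun x => ((Complex.continuous_conj.tendsto _).comp (hQ x)).congr fun n => by
      simp only [Function.comp_apply, inner_conj_symm])
  refine ⟨A.toLinearMap.toPMap ⊤, fun x => ?_, fun x => ?_⟩
  · refine iff_of_true trivial ?_
    calc ∫⁻ z, ‖g z‖ₑ ^ 2 ∂(E.scalarMeasure x)
        ≤ ∫⁻ _, ENNReal.ofReal M ^ 2 ∂(E.scalarMeasure x) := by
          refine lintegral_mono fun z => ?_
          gcongr
          rw [← ofReal_norm]
          exact ENNReal.ofReal_le_ofReal (hM z)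
      _ < ∞ := by
          rw [lintegral_const]
          exact ENNReal.mul_lt_top (by simp) (measure_lt_top _ _)
  · rw [← inner_conj_symm]
    change (starRingEnd ℂ) ⟪A (x : H), (x : H)⟫_ℂ = _
    rw [hA, Complex.conj_conj]

theorem IsIntegral.congr {f g : ℂ → ℂ} {A : H →ₗ.[ℂ] H} (hA : E.IsIntegral f A)
    (h : ∀ x, f =ᵐ[E.scalarMeasure x] g) : E.IsIntegral g A := by
  refine ⟨fun x => ?_, fun x => ?_⟩
  · rw [hA.1]
    have : ∫⁻ z, ‖f z‖ₑ ^ 2 ∂(E.scalarMeasure x) = ∫⁻ z, ‖g z‖ₑ ^ 2 ∂(E.scalarMeasure x) :=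
      lintegral_congr_ae ((h x).mono fun z hz => by simp only [hz])
    rw [this]
  · rw [hA.2]
    exact integral_congr_ae (h x)

/-- `∫ f d(E ∘ h⁻¹) = ∫ f ∘ h dE`. -/
theorem isIntegral_map_iff {f h : ℂ → ℂ} (hf : Measurable f) (hh : Measurable h)
    {A : H →ₗ.[ℂ] H} : (E.map h hh).IsIntegral f A ↔ E.IsIntegral (fun z => f (h z)) A := by
  have h1 : ∀ x, ∫⁻ z, ‖f z‖ₑ ^ 2 ∂((E.map h hh).scalarMeasure x) =
      ∫⁻ z, ‖f (h z)‖ₑ ^ 2 ∂(E.scalarMeasure x) := fun x => by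
    rw [E.scalarMeasure_map hh, lintegral_map (by fun_prop) hh]
  have h2 : ∀ x, ∫ z, f z ∂((E.map h hh).scalarMeasure x) =
      ∫ z, f (h z) ∂(E.scalarMeasure x) := fun x => by
    rw [E.scalarMeasure_map hh, integral_map hh.aemeasurable hf.aestronglyMeasurable]
  simp only [IsIntegral, h1, h2]

end ResolutionOfIdentity

theorem isFunctionOf_functionalCalculus {H : Type*} [NormedAddCommGroup H] [InnerProductSpace ℂ H]
    [CompleteSpace H] {f : ℂ → ℂ} {N A : H →ₗ.[ℂ] H} (h : IsFunctionOf f N A) :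
    IsFunctionOf f N (functionalCalculus f N) := by
  have hex : ∃ A, IsFunctionOf f N A := ⟨A, h⟩
  rw [functionalCalculus, dif_pos hex]
  exact hex.choose_spec

section Multiplication

open Filter Topology

/-- A vector is the sum of its orthogonal projections if Parseval's identity holds for it. -/
theorem hasSum_of_hasSum_norm_sq {H : Type*} [NormedAddCommGroup H] [InnerProductSpace ℂ H]
    (P : ℕ → H → H) (y : H) (h1 : ∀ n, ⟪y, P n y⟫_ℂ = ((‖P n y‖ ^ 2 : ℝ) : ℂ))
    (h2 : ∀ m n, m ≠ n → ⟪P m y, P n y⟫_ℂ = 0)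
    (h : HasSum (fun n => ‖P n y‖ ^ 2) (‖y‖ ^ 2)) : HasSum (fun n => P n y) y := by
  have key : ∀ F : Finset ℕ, ‖∑ n ∈ F, P n y - y‖ ^ 2 = ‖y‖ ^ 2 - ∑ n ∈ F, ‖P n y‖ ^ 2 := by
    intro F
    have a1 : ⟪y, ∑ n ∈ F, P n y⟫_ℂ = ((∑ n ∈ F, ‖P n y‖ ^ 2 : ℝ) : ℂ) := by
      rw [inner_sum, Complex.ofReal_sum]
      exact Finset.sum_congr rfl fun n _ => h1 n
    have a2 : ⟪∑ n ∈ F, P n y, ∑ n ∈ F, P n y⟫_ℂ = ((∑ n ∈ F, ‖P n y‖ ^ 2 : ℝ) : ℂ) := by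
      rw [inner_sum, Complex.ofReal_sum]
      refine Finset.sum_congr rfl fun n hn => ?_
      rw [sum_inner, Finset.sum_eq_single_of_mem n hn fun m _ hmn => h2 m n hmn,
        inner_self_eq_norm_sq_to_K]
      simp
    have a3 : ⟪∑ n ∈ F, P n y, y⟫_ℂ = ((∑ n ∈ F, ‖P n y‖ ^ 2 : ℝ) : ℂ) := by
      rw [← inner_conj_symm, a1, Complex.conj_ofReal]
    have a4 : ⟪∑ n ∈ F, P n y - y, ∑ n ∈ F, P n y - y⟫_ℂ =
        ((‖y‖ ^ 2 - ∑ n ∈ F, ‖P n y‖ ^ 2 : ℝ) : ℂ) := by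
      rw [inner_sub_left, inner_sub_right, inner_sub_right, a1, a2, a3,
        inner_self_eq_norm_sq_to_K]
      simp
    apply Complex.ofReal_injective
    rw [← a4, inner_self_eq_norm_sq_to_K]
    simp
  rw [HasSum, SummationFilter.unconditional_filter, tendsto_iff_norm_sub_tendsto_zero]
  have h0 : Tendsto (fun F : Finset ℕ => ‖y‖ ^ 2 - ∑ n ∈ F, ‖P n y‖ ^ 2) atTop (𝓝 0) := by
    have := (tendsto_const_nhds (x := ‖y‖ ^ 2)).sub h
    rwa [sub_self] at this
  have h3 := (Real.continuous_sqrt.tendsto 0).comp h0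
  rw [Real.sqrt_zero] at h3
  refine h3.congr fun F => ?_
  rw [Function.comp_apply, ← key, Real.sqrt_sq (norm_nonneg _)]

variable {α : Type*} [MeasurableSpace α] {μ : Measure α}

/-- Multiplication by a function `w`, as a map between `L²` spaces of two measures. -/
noncomputable def mulLp {ν : Measure α} (w : α → ℂ) (hν : ν ≪ μ)
    (hw : ∀ f : Lp ℂ 2 μ, MemLp (fun t => w t * f t) 2 ν) : Lp ℂ 2 μ →ₗ[ℂ] Lp ℂ 2 ν where
  toFun f := (hw f).toLp _
  map_add' f g := by
    rw [← MemLp.toLp_add (hw f) (hw g), MemLp.toLp_eq_toLp_iff]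
    filter_upwards [hν.ae_le (Lp.coeFn_add f g)] with t ht
    rw [ht, Pi.add_apply, Pi.add_apply, mul_add]
  map_smul' a f := by
    rw [RingHom.id_apply, ← MemLp.toLp_const_smul a (hw f), MemLp.toLp_eq_toLp_iff]
    filter_upwards [hν.ae_le (Lp.coeFn_smul a f)] with t ht
    rw [ht, Pi.smul_apply, Pi.smul_apply, smul_eq_mul, smul_eq_mul, mul_left_comm]

theorem coeFn_mulLp {ν : Measure α} {w : α → ℂ} (hν : ν ≪ μ)
    (hw : ∀ f : Lp ℂ 2 μ, MemLp (fun t => w t * f t) 2 ν) (f : Lp ℂ 2 μ) :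
    mulLp w hν hw f =ᵐ[ν] fun t => w t * f t :=
  MemLp.coeFn_toLp (hw f)

/-- Multiplication by a bounded measurable function. -/
noncomputable def boundedMul (μ : Measure α) {w : α → ℂ} (hw : Measurable w) {C : ℝ}
    (hC : ∀ t, ‖w t‖ ≤ C) : Lp ℂ 2 μ →L[ℂ] Lp ℂ 2 μ :=
  LinearMap.mkContinuous (mulLp w .rfl fun f => (Lp.memLp f).of_le_mul
    (hw.aestronglyMeasurable.mul (Lp.aestronglyMeasurable f)) (c := C)
    (Eventually.of_forall fun t => by rw [norm_mul]; gcongr; exact hC t)) C fun f => by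
    refine Lp.norm_le_mul_norm_of_ae_le_mul ?_
    filter_upwards [coeFn_mulLp .rfl _ f] with t ht
    rw [ht, norm_mul]
    gcongr
    exact hC t

theorem coeFn_boundedMul {w : α → ℂ} (hw : Measurable w) {C : ℝ} (hC : ∀ t, ‖w t‖ ≤ C)
    (f : Lp ℂ 2 μ) : boundedMul μ hw hC f =ᵐ[μ] fun t => w t * f t :=
  coeFn_mulLp .rfl _ f

/-- Multiplication by the indicator function of a measurable set. -/
noncomputable def indicatorMul (μ : Measure α) {s : Set α} (hs : MeasurableSet s) :
    Lp ℂ 2 μ →L[ℂ] Lp ℂ 2 μ :=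
  boundedMul μ (measurable_one.indicator hs : Measurable (s.indicator (1 : α → ℂ))) (C := 1)
    fun t => by by_cases h : t ∈ s <;> simp [h]

theorem coeFn_indicatorMul {s : Set α} (hs : MeasurableSet s) (f : Lp ℂ 2 μ) :
    indicatorMul μ hs f =ᵐ[μ] s.indicator f := by
  filter_upwards [coeFn_boundedMul (measurable_one.indicator hs) (C := 1) (fun t => by
    by_cases h : t ∈ s <;> simp [h]) f] with t ht
  rw [indicatorMul, ht]
  by_cases h : t ∈ s <;> simp [h]

theorem lintegral_enorm_sq_eq_enorm_sq (f : Lp ℂ 2 μ) : ∫⁻ t, ‖f t‖ₑ ^ 2 ∂μ = ‖f‖ₑ ^ 2 := by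
  have := eLpNorm_nnreal_pow_eq_lintegral (f := f) (μ := μ) (p := 2) two_ne_zero
  rw [Lp.enorm_def]
  simpa using this.symm

theorem enorm_indicatorMul_sq {s : Set α} (hs : MeasurableSet s) (f : Lp ℂ 2 μ) :
    ‖indicatorMul μ hs f‖ₑ ^ 2 = ∫⁻ t in s, ‖f t‖ₑ ^ 2 ∂μ := by
  rw [← lintegral_enorm_sq_eq_enorm_sq, ← lintegral_indicator hs]
  refine lintegral_congr_ae ?_
  filter_upwards [coeFn_indicatorMul hs f] with t ht
  rw [ht]
  by_cases h : t ∈ s <;> simp [h]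

theorem indicatorMul_indicatorMul {s t : Set α} (hs : MeasurableSet s) (ht : MeasurableSet t)
    (f : Lp ℂ 2 μ) :
    indicatorMul μ hs (indicatorMul μ ht f) = indicatorMul μ (hs.inter ht) f := by
  refine Lp.ext ?_
  filter_upwards [coeFn_indicatorMul hs (indicatorMul μ ht f), coeFn_indicatorMul ht f,
    coeFn_indicatorMul (hs.inter ht) f] with z h1 h2 h3
  rw [h1, h3, ← indicator_indicator]
  by_cases h : z ∈ s <;> simp [h, h2]

theorem inner_indicatorMul_left {s : Set α} (hs : MeasurableSet s) (f g : Lp ℂ 2 μ) :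
    ⟪indicatorMul μ hs f, g⟫_ℂ = ⟪f, indicatorMul μ hs g⟫_ℂ := by
  rw [L2.inner_def, L2.inner_def]
  refine integral_congr_ae ?_
  filter_upwards [coeFn_indicatorMul hs f, coeFn_indicatorMul hs g] with z h1 h2
  rw [h1, h2]
  by_cases h : z ∈ s <;> simp [h]

theorem indicatorMul_empty {s : Set α} (hs : MeasurableSet s) (hs0 : s = ∅) :
    indicatorMul μ hs = 0 := by
  ext1 f
  refine Lp.ext ?_
  filter_upwards [coeFn_indicatorMul hs f, Lp.coeFn_zero ℂ 2 μ] with z h1 h2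
  rw [h1, zero_apply, h2, hs0]
  simp

theorem indicatorMul_univ {s : Set α} (hs : MeasurableSet s) (hs0 : s = Set.univ) :
    indicatorMul μ hs = 1 := by
  ext1 f
  refine Lp.ext ?_
  filter_upwards [coeFn_indicatorMul hs f] with z h1
  rw [h1, one_apply_eq_self, hs0]
  simp

variable {H : Type*} [NormedAddCommGroup H] [InnerProductSpace ℂ H]

open Classical in
/-- The spectral projection `W⁻¹ 1_{m⁻¹(s)} W` of the operator `W⁻¹ m W`. -/
noncomputable def multiplicationProj (W : H ≃ₗᵢ[ℂ] Lp ℂ 2 μ) (m : α → ℂ) (s : Set ℂ) : H →L[ℂ] H :=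
  if hs : MeasurableSet (m ⁻¹' s) then
    (W.symm : Lp ℂ 2 μ →L[ℂ] H) ∘L indicatorMul μ hs ∘L (W : H →L[ℂ] Lp ℂ 2 μ)
  else 0

theorem multiplicationProj_apply (W : H ≃ₗᵢ[ℂ] Lp ℂ 2 μ) (m : α → ℂ) {s : Set ℂ}
    (hs : MeasurableSet (m ⁻¹' s)) (x : H) :
    multiplicationProj W m s x = W.symm (indicatorMul μ hs (W x)) := by
  rw [multiplicationProj, dif_pos hs]; rfl

theorem multiplicationProj_multiplicationProj (W : H ≃ₗᵢ[ℂ] Lp ℂ 2 μ) {m : α → ℂ}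
    (hm : Measurable m) {s t : Set ℂ} (hs : MeasurableSet s) (ht : MeasurableSet t) (x : H) :
    multiplicationProj W m s (multiplicationProj W m t x) = multiplicationProj W m (s ∩ t) x := by
  rw [multiplicationProj_apply W m (hm hs), multiplicationProj_apply W m (hm ht),
    multiplicationProj_apply W m (hm (hs.inter ht)), W.apply_symm_apply,
    indicatorMul_indicatorMul]
  rfl

theorem inner_multiplicationProj_left (W : H ≃ₗᵢ[ℂ] Lp ℂ 2 μ) {m : α → ℂ}
    (hm : Measurable m) {s : Set ℂ} (hs : MeasurableSet s) (x y : H) :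
    ⟪multiplicationProj W m s x, y⟫_ℂ = ⟪x, multiplicationProj W m s y⟫_ℂ := by
  rw [multiplicationProj_apply W m (hm hs), multiplicationProj_apply W m (hm hs),
    ← W.inner_map_map, W.apply_symm_apply, inner_indicatorMul_left, ← W.inner_map_map x,
    W.apply_symm_apply]

theorem inner_multiplicationProj_self (W : H ≃ₗᵢ[ℂ] Lp ℂ 2 μ) {m : α → ℂ}
    (hm : Measurable m) {s : Set ℂ} (hs : MeasurableSet s) (x : H) :
    ⟪x, multiplicationProj W m s x⟫_ℂ = ((‖multiplicationProj W m s x‖ ^ 2 : ℝ) : ℂ) := by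
  have h := multiplicationProj_multiplicationProj W hm hs hs x
  rw [inter_self] at h
  rw [← h, ← inner_multiplicationProj_left W hm hs, h, inner_self_eq_norm_sq_to_K]
  simp

theorem multiplicationProj_empty (W : H ≃ₗᵢ[ℂ] Lp ℂ 2 μ) {m : α → ℂ} (hm : Measurable m) :
    multiplicationProj W m ∅ = 0 := by
  ext1 x
  rw [multiplicationProj_apply W m (hm .empty), indicatorMul_empty _ preimage_empty]
  simp

theorem ofReal_norm_multiplicationProj_sq (W : H ≃ₗᵢ[ℂ] Lp ℂ 2 μ) {m : α → ℂ} (hm : Measurable m)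
    {s : Set ℂ} (hs : MeasurableSet s) (x : H) :
    ENNReal.ofReal (‖multiplicationProj W m s x‖ ^ 2) =
      (μ.withDensity fun t => ‖W x t‖ₑ ^ 2).map m s := by
  rw [Measure.map_apply hm hs, withDensity_apply _ (hm hs), ← enorm_indicatorMul_sq (hm hs),
    multiplicationProj_apply W m (hm hs), W.symm.norm_map, ENNReal.ofReal_pow (norm_nonneg _),
    ofReal_norm]

variable [CompleteSpace H]

/-- The resolution of the identity of the operator `W⁻¹ m W` of multiplication by `m`. -/
noncomputable def multiplicationResolution (W : H ≃ₗᵢ[ℂ] Lp ℂ 2 μ) (m : α → ℂ)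
    (hm : Measurable m) : ResolutionOfIdentity H where
  proj := multiplicationProj W m
  isStarProjection s hs := by
    refine ⟨?_, ?_⟩
    · ext1 x
      rw [mul_apply_eq_comp, multiplicationProj_multiplicationProj W hm hs hs, inter_self]
    · exact ((ContinuousLinearMap.eq_adjoint_iff _ _).2 fun x y =>
        inner_multiplicationProj_left W hm hs x y).symm
  empty := multiplicationProj_empty W hm
  univ := by
    ext1 x
    rw [multiplicationProj_apply W m (hm .univ), indicatorMul_univ _ preimage_univ]
    simp
  inter s t hs ht := by
    ext1 x
    rw [mul_apply_eq_comp, multiplicationProj_multiplicationProj W hm hs ht]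
  iUnion s hs hd x := by
    have hU : MeasurableSet (⋃ n, s n) := .iUnion hs
    have hP : ∀ n, multiplicationProj W m (s n) (multiplicationProj W m (⋃ n, s n) x) =
        multiplicationProj W m (s n) x := fun n => by
      rw [multiplicationProj_multiplicationProj W hm (hs n) hU,
        inter_eq_self_of_subset_left (subset_iUnion s n)]
    have h := hasSum_of_hasSum_norm_sq (fun n => multiplicationProj W m (s n))
      (multiplicationProj W m (⋃ n, s n) x)
      (fun n => inner_multiplicationProj_self W hm (hs n) _)
      (fun i j hij => by
        rw [inner_multiplicationProj_left W hm (hs i),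
          multiplicationProj_multiplicationProj W hm (hs i) (hs j),
          Set.disjoint_iff_inter_eq_empty.1 (hd hij), multiplicationProj_empty W hm]
        simp)
      (by
        simp only [hP]
        have h1 := measure_iUnion (μ := (μ.withDensity fun t => ‖W x t‖ₑ ^ 2).map m) hd hs
        simp only [← ofReal_norm_multiplicationProj_sq W hm (hs _),
          ← ofReal_norm_multiplicationProj_sq W hm hU] at h1
        have h2 : Summable fun n => ‖multiplicationProj W m (s n) x‖ ^ 2 := by
          have := ENNReal.summable_toReal (h1 ▸ ENNReal.ofReal_ne_top)
          refine this.congr fun n => ?_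
          rw [ENNReal.toReal_ofReal (by positivity)]
        rw [← ENNReal.ofReal_tsum_of_nonneg (fun n => by positivity) h2,
          ENNReal.ofReal_eq_ofReal_iff (by positivity) (tsum_nonneg fun n => by positivity)] at h1
        rw [h1]
        exact h2.hasSum)
    simpa only [hP] using h

theorem scalarMeasure_multiplicationResolution (W : H ≃ₗᵢ[ℂ] Lp ℂ 2 μ) {m : α → ℂ}
    (hm : Measurable m) (x : H) : (multiplicationResolution W m hm).scalarMeasure x =
      (μ.withDensity fun t => ‖W x t‖ₑ ^ 2).map m := by
  ext s hs
  rw [ResolutionOfIdentity.scalarMeasure_apply _ hs, ← ofReal_norm_multiplicationProj_sq W hm hs]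
  rfl

theorem isIntegral_multiplicationResolution (W : H ≃ₗᵢ[ℂ] Lp ℂ 2 μ) {m : α → ℂ}
    (hm : Measurable m) (N : H →ₗ.[ℂ] H)
    (hdom : ∀ x, x ∈ N.domain ↔ MemLp (fun t => m t * W x t) 2 μ)
    (hN : ∀ x : N.domain, W (N x) =ᵐ[μ] fun t => m t * W x t) :
    (multiplicationResolution W m hm).IsIntegral (fun z => z) N := by
  have hmeas : ∀ x, AEMeasurable (fun t => ‖W x t‖ₑ ^ 2) μ := fun x =>
    (Lp.aestronglyMeasurable (W x)).enorm.pow_const 2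
  refine ⟨fun x => ?_, fun x => ?_⟩
  · rw [hdom, scalarMeasure_multiplicationResolution, lintegral_map (by fun_prop) hm,
      lintegral_withDensity_eq_lintegral_mul₀ (hmeas x) (by fun_prop)]
    have h1 : AEStronglyMeasurable (fun t => m t * W x t) μ :=
      hm.aestronglyMeasurable.mul (Lp.aestronglyMeasurable _)
    rw [MemLp, and_iff_right h1,
      eLpNorm_lt_top_iff_lintegral_rpow_enorm_lt_top two_ne_zero ENNReal.ofNat_ne_top]
    simp [enorm_mul, mul_pow, mul_comm]
  · rw [scalarMeasure_multiplicationResolution,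
      integral_map hm.aemeasurable (by fun_prop),
      integral_withDensity_eq_integral_toReal_smul₀ (hmeas x) (Eventually.of_forall fun t => by simp),
      ← W.inner_map_map, L2.inner_def]
    refine integral_congr_ae ?_
    filter_upwards [hN x] with t ht
    rw [ht, RCLike.inner_apply, ENNReal.toReal_pow, toReal_enorm, Complex.real_smul, mul_assoc,
      Complex.mul_conj, Complex.normSq_eq_norm_sq, mul_comm]

theorem proj_multiplicationResolution_ne_zero (W : H ≃ₗᵢ[ℂ] Lp ℂ 2 μ) {m : α → ℂ}
    (hm : Measurable m) {s : Set ℂ} (hs : MeasurableSet s) {u : Set α} (hu : MeasurableSet u)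
    (hus : u ⊆ m ⁻¹' s) (hu0 : μ u ≠ 0) (hu1 : μ u ≠ ∞) :
    (multiplicationResolution W m hm).proj s ≠ 0 := by
  intro h0
  have h1 : (multiplicationResolution W m hm).scalarMeasure
      (W.symm (indicatorConstLp 2 hu hu1 (1 : ℂ))) s = 0 := by
    rw [ResolutionOfIdentity.scalarMeasure_eq_zero_iff _ hs, h0, zero_apply]
  rw [scalarMeasure_multiplicationResolution, Measure.map_apply hm hs,
    withDensity_apply _ (hm hs), W.apply_symm_apply] at h1
  apply hu0
  refine le_antisymm ?_ zero_le
  rw [← h1]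
  calc μ u = ∫⁻ t in u, ‖indicatorConstLp 2 hu hu1 (1 : ℂ) t‖ₑ ^ 2 ∂μ := by
        rw [← setLIntegral_one u]
        refine setLIntegral_congr_fun_ae hu ?_
        filter_upwards [indicatorConstLp_coeFn (p := 2) (hs := hu) (hμs := hu1) (c := (1 : ℂ))]
          with t ht htu
        rw [ht, indicator_of_mem htu]; simp
    _ ≤ _ := lintegral_mono_set hus

end Multiplication

section WeakDerivative

open Filter Topology SchwartzMap FourierTransform
open scoped LineDeriv

/-- A primitive of a locally integrable function is locally absolutely continuous. -/
theorem absolutelyContinuousOnInterval_integral {f : ℝ → ℂ} (hf : LocallyIntegrable f volume)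
    (c a b : ℝ) : AbsolutelyContinuousOnInterval (fun x => ∫ v in c..x, f v) a b := by
  have hint : ∀ x y, IntervalIntegrable f volume x y := fun x y =>
    intervalIntegrable_iff.2 <|
      (hf.integrableOn_isCompact isCompact_uIcc).mono_set uIoc_subset_uIcc
  have hre : AbsolutelyContinuousOnInterval (fun x => ∫ v in c..x, (f v).re)
      (min c (min a b)) (max c (max a b)) :=
    IntervalIntegrable.absolutelyContinuousOnInterval_intervalIntegral
      (intervalIntegrable_iff.2 (Complex.reCLM.integrable_comp
        (intervalIntegrable_iff.1 (hint _ _))))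
      (by rw [uIcc_of_le (by simp)]; simp)
  have him : AbsolutelyContinuousOnInterval (fun x => ∫ v in c..x, (f v).im)
      (min c (min a b)) (max c (max a b)) :=
    IntervalIntegrable.absolutelyContinuousOnInterval_intervalIntegral
      (intervalIntegrable_iff.2 (Complex.imCLM.integrable_comp
        (intervalIntegrable_iff.1 (hint _ _))))
      (by rw [uIcc_of_le (by simp)]; simp)
  have hconst : ∀ z : ℂ, AbsolutelyContinuousOnInterval (fun _ : ℝ => z)
      (min c (min a b)) (max c (max a b)) := fun z =>
    (LipschitzWith.const z).lipschitzOnWith.absolutelyContinuousOnInterval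
  have h := (hre.smul (hconst 1)).add (him.smul (hconst Complex.I))
  refine AbsolutelyContinuousOnInterval.mono ?_ (a := min c (min a b)) (b := max c (max a b)) ?_
  · convert! h using 1
    ext x
    have h1 := Complex.reCLM.intervalIntegral_comp_comm (hint c x)
    have h2 := Complex.imCLM.intervalIntegral_comp_comm (hint c x)
    simp only [Complex.reCLM_apply, Complex.imCLM_apply] at h1 h2
    simp only [Pi.add_apply, Pi.smul_apply', h1, h2, Complex.real_smul, mul_one, Complex.re_add_im]
  · rw [uIcc_of_le (by simp : min c (min a b) ≤ max c (max a b))]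
    exact Icc_subset_Icc (min_le_right _ _) (le_max_right _ _)

/-- `k` is the almost everywhere derivative of a locally absolutely continuous version of `g`. -/
def IsAEDeriv (g k : Lp ℂ 2 (volume : Measure ℝ)) : Prop :=
  ∃ F : ℝ → ℂ, (∀ a b : ℝ, AbsolutelyContinuousOnInterval F a b) ∧ (∀ᵐ t, g t = F t) ∧
    ∀ᵐ t, HasDerivAt F (k t) t

theorem tendsto_intervalIntegral_of_tendsto_Lp {k : ℕ → Lp ℂ 2 (volume : Measure ℝ)}
    {l : Lp ℂ 2 (volume : Measure ℝ)} (h : Tendsto k atTop (𝓝 l)) (a b : ℝ) :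
    Tendsto (fun n => ∫ t in a..b, k n t) atTop (𝓝 (∫ t in a..b, l t)) := by
  have key : ∀ x y : ℝ, Tendsto (fun n => ∫ t in Ioc x y, k n t) atTop
      (𝓝 (∫ t in Ioc x y, l t)) := fun x y => by
    have hμ : volume (Ioc x y) ≠ ∞ := by simp
    simp only [← L2.inner_indicatorConstLp_one (𝕜 := ℂ) measurableSet_Ioc hμ]
    exact tendsto_const_nhds.inner h
  exact (key a b).sub (key b a)

/-- The weak derivative is closed. -/
theorem isAEDeriv_of_tendsto {f : ℕ → 𝓢(ℝ, ℂ)} {g k : Lp ℂ 2 (volume : Measure ℝ)}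
    (hg : Tendsto (fun n => (f n).toLp 2) atTop (𝓝 g))
    (hk : Tendsto (fun n => (∂_{(1 : ℝ)} (f n)).toLp 2) atTop (𝓝 k)) : IsAEDeriv g k := by
  obtain ⟨ns, hns, hlim⟩ := (tendstoInMeasure_of_tendsto_Lp hg).exists_seq_tendsto_ae
  have hlim' : ∀ᵐ t, Tendsto (fun i => f (ns i) t) atTop (𝓝 (g t)) := by
    filter_upwards [hlim, (ae_all_iff (μ := (volume : Measure ℝ))
      (p := fun t n => (f n).toLp 2 volume t = f n t)).2 fun n =>
      (f n).coeFn_toLp 2 volume] with t h1 h2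
    simpa only [h2] using h1
  obtain ⟨t₀, ht₀⟩ := hlim'.exists
  have hint : LocallyIntegrable k volume := (Lp.memLp k).locallyIntegrable one_le_two
  have hF : ∀ t, Tendsto (fun i => f (ns i) t) atTop (𝓝 (g t₀ + ∫ s in t₀..t, k s)) := by
    intro t
    refine (ht₀.add ((tendsto_intervalIntegral_of_tendsto_Lp hk t₀ t).comp
      hns.tendsto_atTop)).congr fun i => ?_
    have e1 : ∫ s in t₀..t, (∂_{(1 : ℝ)} (f (ns i))).toLp 2 volume s =
        ∫ s in t₀..t, deriv (f (ns i)) s := by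
      refine intervalIntegral.integral_congr_ae ?_
      filter_upwards [(∂_{(1 : ℝ)} (f (ns i))).coeFn_toLp 2] with s hs _
      rw [hs, lineDerivOp_apply_eq_fderiv, fderiv_apply_one_eq_deriv]
    have hcont : Continuous (deriv (f (ns i))) := (f (ns i)).smooth 1 |>.continuous_deriv le_rfl
    rw [Function.comp_apply, e1, intervalIntegral.integral_deriv_eq_sub
      (fun x _ => (f (ns i)).differentiableAt) (hcont.intervalIntegrable _ _)]
    ring
  refine ⟨fun t => g t₀ + ∫ s in t₀..t, k s, fun a b => ?_, ?_, ?_⟩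
  · exact AbsolutelyContinuousOnInterval.add
      ((LipschitzWith.const (g t₀)).lipschitzOnWith.absolutelyContinuousOnInterval)
      (absolutelyContinuousOnInterval_integral hint t₀ a b)
  · filter_upwards [hlim'] with t ht using tendsto_nhds_unique ht (hF t)
  · filter_upwards [LocallyIntegrable.ae_hasDerivAt_integral hint] with t ht
    exact (ht t₀).const_add _

theorem IsAEDeriv.sub {g g' k k' : Lp ℂ 2 (volume : Measure ℝ)} (h : IsAEDeriv g k)
    (h' : IsAEDeriv g' k') : IsAEDeriv (g - g') (k - k') := by
  obtain ⟨F, hF, hgF, hF'⟩ := h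
  obtain ⟨G, hG, hgG, hG'⟩ := h'
  refine ⟨F - G, fun a b => (hF a b).sub (hG a b), ?_, ?_⟩
  · filter_upwards [hgF, hgG, Lp.coeFn_sub g g'] with t h1 h2 h3
    rw [h3, Pi.sub_apply, h1, h2, Pi.sub_apply]
  · filter_upwards [hF', hG', Lp.coeFn_sub k k'] with t h1 h2 h3
    rw [h3]
    exact h1.sub h2

/-- Multiplication by an exponential preserves local absolute continuity. -/
theorem absolutelyContinuousOnInterval_exp_smul {F : ℝ → ℂ}
    (hF : ∀ a b : ℝ, AbsolutelyContinuousOnInterval F a b) (c a b : ℝ) :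
    AbsolutelyContinuousOnInterval (fun t => Real.exp (c * t) • F t) a b := by
  have h : AbsolutelyContinuousOnInterval (fun t => Real.exp (c * t)) a b :=
    ContDiffOn.absolutelyContinuousOnInterval (by fun_prop)
  exact h.smul (hF a b)

theorem hasDerivAt_exp_smul {F : ℝ → ℂ} {k : ℂ} {t : ℝ} (c : ℝ) (h : HasDerivAt F k t) :
    HasDerivAt (fun t => Real.exp (c * t) • F t) (Real.exp (c * t) • (k + c * F t)) t := by
  have h1 : HasDerivAt (fun t => Real.exp (c * t)) (Real.exp (c * t) * c) t := by
    simpa using ((hasDerivAt_id t).const_mul c).exp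
  convert! h1.smul h using 1
  simp only [Complex.real_smul]
  push_cast
  ring

/-- `1 + d/dt` is injective on `L²`. -/
theorem IsAEDeriv.eq_zero_of_add_eq_zero {g k : Lp ℂ 2 (volume : Measure ℝ)} (h : IsAEDeriv g k)
    (hgk : g + k = 0) : g = 0 := by
  obtain ⟨F, hF, hgF, hF'⟩ := h
  have hk : k = -g := eq_neg_of_add_eq_zero_right hgk
  have hder : ∀ᵐ t, HasDerivAt (fun t => Real.exp (1 * t) • F t) 0 t := by
    filter_upwards [hgF, hF', Lp.coeFn_neg g] with t h1 h2 h3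
    have h4 := hasDerivAt_exp_smul 1 h2
    rw [hk, h3, Pi.neg_apply, h1] at h4
    simpa using h4
  have hconst : ∀ t, Real.exp (1 * t) • F t = F 0 := by
    intro t
    obtain ⟨C, hC⟩ := (absolutelyContinuousOnInterval_exp_smul hF 1 0 t).const_of_ae_hasDerivAt_zero
      (hder.mono fun x hx _ => hx)
    rw [hC t right_mem_uIcc, ← hC 0 left_mem_uIcc]
    simp
  have hFt : ∀ t, F t = Real.exp (-t) • F 0 := fun t => by
    rw [← hconst t, smul_smul, one_mul, ← Real.exp_add, neg_add_cancel, Real.exp_zero, one_smul]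
  have h0 : F 0 = 0 := by
    by_contra hne
    have hfin : ∫⁻ t, ‖g t‖ₑ ^ 2 < ∞ := by
      rw [lintegral_enorm_sq_eq_enorm_sq]
      exact ENNReal.pow_lt_top enorm_lt_top
    have hle : ∫⁻ _ in Iic (0 : ℝ), ‖F 0‖ₑ ^ 2 ≤ ∫⁻ t, ‖g t‖ₑ ^ 2 := by
      refine le_trans ?_ (setLIntegral_le_lintegral (Iic (0 : ℝ)) _)
      refine setLIntegral_mono_ae' measurableSet_Iic ?_
      filter_upwards [hgF] with t ht hmem
      rw [ht, hFt t, enorm_smul]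
      gcongr
      refine le_mul_of_one_le_left zero_le ?_
      rw [← ofReal_norm, Real.norm_of_nonneg (Real.exp_pos _).le, ENNReal.one_le_ofReal]
      exact Real.one_le_exp (by simpa using hmem)
    rw [setLIntegral_const, Real.volume_Iic, ENNReal.mul_top (by simpa using hne)] at hle
    exact absurd hfin (not_lt.2 hle)
  rw [Lp.eq_zero_iff_ae_eq_zero]
  filter_upwards [hgF] with t ht
  rw [ht, hFt, h0, smul_zero, Pi.zero_apply]

end WeakDerivative

section FourierDerivative

open Filter Topology SchwartzMap FourierTransform
open scoped LineDeriv Real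

/-- The Bessel potential multiplier of order one. -/
noncomputable def besselWeight (ξ : ℝ) : ℂ := (((1 + ‖ξ‖ ^ 2) ^ (-(1 / 2) : ℝ) : ℝ) : ℂ)

theorem measurable_besselWeight : Measurable besselWeight := by
  unfold besselWeight; fun_prop

theorem norm_besselWeight (ξ : ℝ) : ‖besselWeight ξ‖ = (√(1 + ‖ξ‖ ^ 2))⁻¹ := by
  rw [besselWeight, Complex.norm_real, Real.norm_of_nonneg (by positivity),
    Real.rpow_neg (by positivity), Real.sqrt_eq_rpow]

theorem norm_besselWeight_le (ξ : ℝ) : ‖besselWeight ξ‖ ≤ 1 := by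
  rw [norm_besselWeight]
  refine inv_le_one_of_one_le₀ ?_
  rw [Real.one_le_sqrt]
  nlinarith [norm_nonneg ξ]

theorem besselWeight_ne_zero (ξ : ℝ) : besselWeight ξ ≠ 0 := by
  rw [← norm_pos_iff, norm_besselWeight]
  positivity

theorem norm_mul_besselWeight_le (ξ : ℝ) : ‖2 * π * Complex.I * ξ * besselWeight ξ‖ ≤ 2 * π := by
  rw [norm_mul, norm_besselWeight, norm_mul, norm_mul, norm_mul, Complex.norm_I, Complex.norm_real,
    Complex.norm_real, Complex.norm_ofNat, mul_one, Real.norm_of_nonneg Real.pi_pos.le, mul_assoc]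
  refine mul_le_of_le_one_right (by positivity) ?_
  rw [← div_eq_mul_inv, div_le_one (by positivity)]
  exact Real.le_sqrt_of_sq_le (by linarith)

theorem norm_inv_besselWeight_le (ξ : ℝ) : ‖(besselWeight ξ)⁻¹‖ ≤ 1 + ‖2 * π * Complex.I * ξ‖ := by
  rw [norm_inv, norm_besselWeight, inv_inv, norm_mul, norm_mul, norm_mul, Complex.norm_I,
    Complex.norm_real, Complex.norm_real, Complex.norm_ofNat, mul_one,
    Real.norm_of_nonneg Real.pi_pos.le]
  refine Real.sqrt_le_iff.2 ⟨by positivity, ?_⟩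
  have hπ : 1 ≤ 2 * π := by linarith [Real.two_le_pi]
  have h2 : ‖ξ‖ ≤ 2 * π * ‖ξ‖ := le_mul_of_one_le_left (norm_nonneg _) hπ
  nlinarith [norm_nonneg ξ]

/-- The weak derivative is multiplication by `2πiξ` on the Fourier side: sufficiency. -/
theorem isAEDeriv_of_fourier {g k : Lp ℂ 2 (volume : Measure ℝ)}
    (h : (𝓕 k : Lp ℂ 2 volume) =ᵐ[volume] fun ξ : ℝ => 2 * π * Complex.I * ξ * (𝓕 g : Lp ℂ 2 volume) ξ) :
    IsAEDeriv g k := by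
  have hmeas : Measurable fun ξ : ℝ => 2 * π * Complex.I * ξ * besselWeight ξ :=
    (by fun_prop : Measurable fun ξ : ℝ => 2 * π * Complex.I * (ξ : ℂ)).mul
      measurable_besselWeight
  let S := boundedMul (volume : Measure ℝ) measurable_besselWeight norm_besselWeight_le
  let D := boundedMul (volume : Measure ℝ) hmeas norm_mul_besselWeight_le
  have hp : MemLp (fun ξ => (besselWeight ξ)⁻¹ * (𝓕 g : Lp ℂ 2 volume) ξ) 2 volume := by
    refine MemLp.mono ((Lp.memLp (𝓕 g : Lp ℂ 2 volume)).norm.add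
      (Lp.memLp (𝓕 k : Lp ℂ 2 volume)).norm)
      (measurable_besselWeight.inv.aestronglyMeasurable.mul (Lp.aestronglyMeasurable _)) ?_
    filter_upwards [h] with ξ hξ
    rw [Pi.add_apply, hξ, norm_mul, norm_mul (2 * π * Complex.I * (ξ : ℂ)),
      Real.norm_of_nonneg (by positivity)]
    have := mul_le_mul_of_nonneg_right (norm_inv_besselWeight_le ξ)
      (norm_nonneg ((𝓕 g : Lp ℂ 2 volume) ξ))
    linarith
  have hSp : S (hp.toLp _) = 𝓕 g := by
    refine Lp.ext ?_
    filter_upwards [coeFn_boundedMul measurable_besselWeight norm_besselWeight_le (hp.toLp _),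
      hp.coeFn_toLp] with ξ h1 h2
    rw [h1, h2, mul_inv_cancel_left₀ (besselWeight_ne_zero ξ)]
  have hDp : D (hp.toLp _) = 𝓕 k := by
    refine Lp.ext ?_
    filter_upwards [coeFn_boundedMul hmeas norm_mul_besselWeight_le (hp.toLp _),
      hp.coeFn_toLp, h] with ξ h1 h2 h3
    rw [h1, h2, h3, mul_assoc, mul_inv_cancel_left₀ (besselWeight_ne_zero ξ)]
  obtain ⟨q, hq, hqlim⟩ := mem_closure_iff_seq_limit.1
    (SchwartzMap.denseRange_toLpCLM (E := ℝ) (F := ℂ) (μ := volume) (p := 2)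
      ENNReal.ofNat_ne_top (hp.toLp _))
  choose p hpq using hq
  have hplim : Tendsto (fun n => (p n).toLp 2 volume) atTop (𝓝 (hp.toLp _)) :=
    hqlim.congr fun n => (hpq n).symm
  have hbw : (fun ξ : ℝ => (1 + ‖ξ‖ ^ 2) ^ (-(1 / 2) : ℝ)).HasTemperateGrowth := by fun_prop
  have hin : (fun ξ : ℝ => inner ℝ ξ (1 : ℝ)).HasTemperateGrowth := by fun_prop
  let u : ℕ → 𝓢(ℝ, ℂ) := fun n =>
    smulLeftCLM ℂ (fun ξ : ℝ => (1 + ‖ξ‖ ^ 2) ^ (-(1 / 2) : ℝ)) (p n)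
  have hu : ∀ n, (u n).toLp 2 volume = S ((p n).toLp 2 volume) := fun n => by
    refine Lp.ext ?_
    filter_upwards [(u n).coeFn_toLp 2 volume, (p n).coeFn_toLp 2 volume,
      coeFn_boundedMul measurable_besselWeight norm_besselWeight_le ((p n).toLp 2 volume)]
      with ξ h1 h2 h3
    rw [h1, h3, h2, smulLeftCLM_apply_apply hbw, Complex.real_smul]
    rfl
  have hu' : ∀ n, ((2 * π * Complex.I) • smulLeftCLM ℂ (fun ξ : ℝ => inner ℝ ξ (1 : ℝ)) (u n)).toLp
      2 volume = D ((p n).toLp 2 volume) := fun n => by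
    refine Lp.ext ?_
    filter_upwards [((2 * π * Complex.I) •
      smulLeftCLM ℂ (fun ξ : ℝ => inner ℝ ξ (1 : ℝ)) (u n)).coeFn_toLp 2 volume,
      (p n).coeFn_toLp 2 volume,
      coeFn_boundedMul hmeas norm_mul_besselWeight_le ((p n).toLp 2 volume)] with ξ h1 h2 h3
    rw [h1, h3, h2, smul_apply, smulLeftCLM_apply_apply hin,
      smulLeftCLM_apply_apply hbw, Complex.real_smul, Complex.real_smul, besselWeight]
    simp [mul_assoc]
  refine isAEDeriv_of_tendsto (f := fun n => 𝓕⁻ (u n)) ?_ ?_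
  · have h1 := (Lp.fourierTransformₗᵢ ℝ ℂ).symm.continuous.tendsto (𝓕 g) |>.comp
      (hSp ▸ (S.continuous.tendsto _).comp hplim)
    have h2 : (Lp.fourierTransformₗᵢ ℝ ℂ).symm (𝓕 g) = g :=
      (Lp.fourierTransformₗᵢ ℝ ℂ).symm_apply_apply g
    rw [h2] at h1
    refine h1.congr fun n => ?_
    rw [← SchwartzMap.toLp_fourierInv_eq, hu n]
    rfl
  · have h1 := (Lp.fourierTransformₗᵢ ℝ ℂ).symm.continuous.tendsto (𝓕 k) |>.comp
      (hDp ▸ (D.continuous.tendsto _).comp hplim)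
    have h2 : (Lp.fourierTransformₗᵢ ℝ ℂ).symm (𝓕 k) = k :=
      (Lp.fourierTransformₗᵢ ℝ ℂ).symm_apply_apply k
    rw [h2] at h1
    refine h1.congr fun n => ?_
    rw [lineDerivOp_fourierInv_eq, ← SchwartzMap.toLp_fourierInv_eq, hu' n]
    rfl

theorem one_add_mul_I_ne_zero (ξ : ℝ) : 1 + 2 * π * Complex.I * (ξ : ℂ) ≠ 0 := by
  intro h
  have := congrArg Complex.re h
  simp at this

theorem norm_inv_one_add_le (ξ : ℝ) : ‖(1 + 2 * π * Complex.I * (ξ : ℂ))⁻¹‖ ≤ 1 := by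
  rw [norm_inv]
  refine inv_le_one_of_one_le₀ ?_
  have := Complex.abs_re_le_norm (1 + 2 * π * Complex.I * (ξ : ℂ))
  simpa using this

/-- The weak derivative is multiplication by `2πiξ` on the Fourier side. -/
theorem isAEDeriv_iff_fourier {g k : Lp ℂ 2 (volume : Measure ℝ)} :
    IsAEDeriv g k ↔
      (𝓕 k : Lp ℂ 2 volume) =ᵐ[volume] fun ξ : ℝ => 2 * π * Complex.I * ξ * (𝓕 g : Lp ℂ 2 volume) ξ := by
  refine ⟨fun h => ?_, isAEDeriv_of_fourier⟩
  have hmeas : Measurable fun ξ : ℝ => (1 + 2 * π * Complex.I * (ξ : ℂ))⁻¹ := by fun_prop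
  let R := boundedMul (volume : Measure ℝ) hmeas norm_inv_one_add_le
  set g₀ : Lp ℂ 2 (volume : Measure ℝ) := 𝓕⁻ (R (𝓕 (g + k))) with hg₀
  set k₀ : Lp ℂ 2 (volume : Measure ℝ) := g + k - g₀ with hk₀
  have e1 : 𝓕 g₀ = R (𝓕 (g + k)) := fourier_fourierInv_eq _
  have e2 : 𝓕 k₀ = 𝓕 (g + k) - 𝓕 g₀ := (Lp.fourierTransformₗᵢ ℝ ℂ).map_sub _ _
  have h₀ : (𝓕 k₀ : Lp ℂ 2 volume) =ᵐ[volume] fun ξ : ℝ =>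
      2 * π * Complex.I * ξ * (𝓕 g₀ : Lp ℂ 2 volume) ξ := by
    rw [e2]
    filter_upwards [Lp.coeFn_sub (𝓕 (g + k)) (𝓕 g₀),
      coeFn_boundedMul hmeas norm_inv_one_add_le (𝓕 (g + k))] with ξ h1 h2
    rw [h1, Pi.sub_apply, e1, h2]
    field_simp [one_add_mul_I_ne_zero ξ]
    ring
  have hd := h.sub (isAEDeriv_of_fourier h₀)
  have hz : g - g₀ = 0 := hd.eq_zero_of_add_eq_zero (by rw [hk₀]; abel)
  have hg : g = g₀ := sub_eq_zero.1 hz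
  have hk : k = k₀ := by rw [hk₀, ← hg]; abel
  rw [hg, hk]
  exact h₀

end FourierDerivative

section Momentum

open Filter Topology FourierTransform
open scoped Real

theorem weightMeasure_absolutelyContinuous_volume (c : ℝ) :
    weightMeasure c ≪ (volume : Measure ℝ) :=
  withDensity_absolutelyContinuous _ _

theorem ae_weightMeasure_iff (c : ℝ) {p : ℝ → Prop} :
    (∀ᵐ t ∂(weightMeasure c), p t) ↔ ∀ᵐ t, p t :=
  ⟨fun h => (volume_absolutelyContinuous_weightMeasure c).ae_le h,
    fun h => (weightMeasure_absolutelyContinuous_volume c).ae_le h⟩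

theorem lintegral_weightMeasure (c : ℝ) {f : ℝ → ℂ} (hf : AEStronglyMeasurable f volume) :
    ∫⁻ t, ‖f t‖ₑ ^ 2 ∂(weightMeasure c) = ∫⁻ t, ‖(Real.exp (-c * t) : ℂ) * f t‖ₑ ^ 2 := by
  rw [weightMeasure, lintegral_withDensity_eq_lintegral_mul₀ (by fun_prop) (hf.enorm.pow_const 2)]
  refine lintegral_congr fun t => ?_
  rw [Pi.mul_apply, enorm_mul, mul_pow]
  congr 1
  rw [← ofReal_norm, Complex.norm_real, Real.norm_of_nonneg (Real.exp_pos _).le,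
    ← ENNReal.ofReal_pow (Real.exp_pos _).le, ← Real.exp_nat_mul]
  congr 2
  push_cast
  ring

theorem memLp_weightMeasure_iff (c : ℝ) {f : ℝ → ℂ} (hf : AEStronglyMeasurable f volume) :
    MemLp f 2 (weightMeasure c) ↔ MemLp (fun t => (Real.exp (-c * t) : ℂ) * f t) 2 volume := by
  have h1 : AEStronglyMeasurable f (weightMeasure c) :=
    hf.mono_ac (weightMeasure_absolutelyContinuous_volume c)
  have h2 : AEStronglyMeasurable (fun t => (Real.exp (-c * t) : ℂ) * f t) volume :=
    AEStronglyMeasurable.mul (by fun_prop) hf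
  rw [MemLp, MemLp, and_iff_right h1, and_iff_right h2,
    eLpNorm_lt_top_iff_lintegral_rpow_enorm_lt_top two_ne_zero ENNReal.ofNat_ne_top,
    eLpNorm_lt_top_iff_lintegral_rpow_enorm_lt_top two_ne_zero ENNReal.ofNat_ne_top]
  have := lintegral_weightMeasure c hf
  simp only [ENNReal.toReal_ofNat, ENNReal.rpow_ofNat]
  rw [this]

theorem aestronglyMeasurable_volume (c : ℝ) (f : HilbertSpace c) :
    AEStronglyMeasurable f (volume : Measure ℝ) :=
  (Lp.aestronglyMeasurable f).mono_ac (volume_absolutelyContinuous_weightMeasure c)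

/-- Multiplication by `e^{-ct}`, from `ℍ_c` to `L²(ℝ)`. -/
noncomputable def unweightLinearMap (c : ℝ) :
    HilbertSpace c →ₗ[ℂ] Lp ℂ 2 (volume : Measure ℝ) :=
  mulLp (fun t => (Real.exp (-c * t) : ℂ)) (volume_absolutelyContinuous_weightMeasure c) fun f =>
    (memLp_weightMeasure_iff c (aestronglyMeasurable_volume c f)).1 (Lp.memLp f)

theorem coeFn_unweightLinearMap (c : ℝ) (f : HilbertSpace c) :
    unweightLinearMap c f =ᵐ[volume] fun t => (Real.exp (-c * t) : ℂ) * f t :=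
  coeFn_mulLp _ _ f

theorem norm_unweightLinearMap (c : ℝ) (f : HilbertSpace c) : ‖unweightLinearMap c f‖ = ‖f‖ := by
  have h : ‖unweightLinearMap c f‖ₑ ^ 2 = ‖f‖ₑ ^ 2 := by
    rw [← lintegral_enorm_sq_eq_enorm_sq, ← lintegral_enorm_sq_eq_enorm_sq,
      lintegral_weightMeasure c (aestronglyMeasurable_volume c f)]
    refine lintegral_congr_ae ?_
    filter_upwards [coeFn_unweightLinearMap c f] with t ht
    rw [ht]
  rw [← ofReal_norm, ← ofReal_norm, ← ENNReal.ofReal_pow (norm_nonneg _),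
    ← ENNReal.ofReal_pow (norm_nonneg _),
    ENNReal.ofReal_eq_ofReal_iff (by positivity) (by positivity)] at h
  exact (pow_left_inj₀ (norm_nonneg _) (norm_nonneg _) two_ne_zero).1 h

theorem surjective_unweightLinearMap (c : ℝ) : Function.Surjective (unweightLinearMap c) := by
  intro g
  have hmeas : AEStronglyMeasurable (fun t => (Real.exp (c * t) : ℂ) * g t) volume :=
    AEStronglyMeasurable.mul (by fun_prop) (Lp.aestronglyMeasurable g)
  have hcancel : ∀ t, (Real.exp (-c * t) : ℂ) * ((Real.exp (c * t) : ℂ) * g t) = g t := fun t => by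
    rw [← mul_assoc, ← Complex.ofReal_mul, ← Real.exp_add]
    simp
  have hmem : MemLp (fun t => (Real.exp (c * t) : ℂ) * g t) 2 (weightMeasure c) := by
    rw [memLp_weightMeasure_iff c hmeas]
    simp only [hcancel]
    exact Lp.memLp g
  refine ⟨hmem.toLp _, Lp.ext ?_⟩
  filter_upwards [coeFn_unweightLinearMap c (hmem.toLp _),
    (ae_weightMeasure_iff c).1 hmem.coeFn_toLp] with t h1 h2
  rw [h1, h2, hcancel]

/-- Multiplication by `e^{-ct}`, as a unitary operator from `ℍ_c` onto `L²(ℝ)`. -/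
noncomputable def unweight (c : ℝ) : HilbertSpace c ≃ₗᵢ[ℂ] Lp ℂ 2 (volume : Measure ℝ) :=
  LinearIsometryEquiv.ofSurjective
    { toLinearMap := unweightLinearMap c, norm_map' := norm_unweightLinearMap c }
    (surjective_unweightLinearMap c)

theorem coeFn_unweight (c : ℝ) (f : HilbertSpace c) :
    unweight c f =ᵐ[volume] fun t => (Real.exp (-c * t) : ℂ) * f t :=
  coeFn_unweightLinearMap c f

theorem mem_shiftGraph_iff (c : ℝ) (x y : HilbertSpace c) :
    (x, y) ∈ shiftGraph c ↔ IsAEDeriv (unweight c x) (unweight c (y - (c : ℂ) • x)) := by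
  have hx := coeFn_unweight c x
  have hy : ∀ᵐ t, unweight c (y - (c : ℂ) • x) t = (Real.exp (-c * t) : ℂ) * (y t - c * x t) := by
    filter_upwards [coeFn_unweight c (y - (c : ℂ) • x),
      (ae_weightMeasure_iff c).1 (Lp.coeFn_sub y ((c : ℂ) • x)),
      (ae_weightMeasure_iff c).1 (Lp.coeFn_smul (c : ℂ) x)] with t h1 h2 h3
    rw [h1, h2, Pi.sub_apply, h3, Pi.smul_apply, smul_eq_mul]
  constructor
  · rintro ⟨F, hF, hxF, hF'⟩
    rw [ae_weightMeasure_iff] at hxF hF'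
    refine ⟨fun t => Real.exp (-c * t) • F t, absolutelyContinuousOnInterval_exp_smul hF (-c),
      ?_, ?_⟩
    · filter_upwards [hx, hxF] with t h1 h2
      rw [h1, Complex.real_smul, ← h2]
    · filter_upwards [hy, hxF, hF'] with t h1 h2 h3
      have h4 := hasDerivAt_exp_smul (-c) h3
      rw [h1]
      convert! h4 using 1
      rw [Complex.real_smul, ← h2]
      push_cast
      ring
  · rintro ⟨G, hG, hxG, hG'⟩
    refine ⟨fun t => Real.exp (c * t) • G t, absolutelyContinuousOnInterval_exp_smul hG c, ?_, ?_⟩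
    · rw [ae_weightMeasure_iff]
      filter_upwards [hx, hxG] with t h1 h2
      rw [← h2, h1, Complex.real_smul, ← mul_assoc, ← Complex.ofReal_mul, ← Real.exp_add]
      simp
    · rw [ae_weightMeasure_iff]
      filter_upwards [hx, hy, hxG, hG'] with t h1 h2 h3 h4
      have h5 := hasDerivAt_exp_smul c h4
      convert! h5 using 1
      rw [h2, ← h3, h1, Complex.real_smul, mul_left_comm (c : ℂ), ← mul_add, ← mul_assoc,
        ← Complex.ofReal_mul, ← Real.exp_add]
      simp

/-- The unitary operator that diagonalizes the momentum operator. -/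
noncomputable def weightedFourier (c : ℝ) : HilbertSpace c ≃ₗᵢ[ℂ] Lp ℂ 2 (volume : Measure ℝ) :=
  (unweight c).trans (Lp.fourierTransformₗᵢ ℝ ℂ)

theorem mem_shiftGraph_iff_fourier (c : ℝ) (x y : HilbertSpace c) :
    (x, y) ∈ shiftGraph c ↔ weightedFourier c (y - (c : ℂ) • x) =ᵐ[volume]
      fun ξ : ℝ => 2 * π * Complex.I * ξ * weightedFourier c x ξ := by
  rw [mem_shiftGraph_iff, isAEDeriv_iff_fourier]
  rfl

theorem mem_domain_momentum_iff (c : ℝ) (x : HilbertSpace c) :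
    x ∈ (momentum c).domain ↔ ∃ y, (x, y) ∈ shiftGraph c := by
  rw [← infinitesimalShift_graph, ← LinearPMap.mem_domain_iff]
  change x ∈ (infinitesimalShift c).domain ⊓ ⊤ ↔ _
  rw [inf_top_eq]

theorem smul_momentum_mem_shiftGraph (c : ℝ) (x : (momentum c).domain) :
    ((x : HilbertSpace c), Complex.I • momentum c x + (c : ℂ) • (x : HilbertSpace c)) ∈
      shiftGraph c := by
  have hx : (x : HilbertSpace c) ∈ (infinitesimalShift c).domain := by
    rw [LinearPMap.mem_domain_iff, infinitesimalShift_graph, ← mem_domain_momentum_iff]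
    exact x.2
  have h : momentum c x = (Complex.I)⁻¹ •
      (infinitesimalShift c ⟨x, hx⟩ - (c : ℂ) • (x : HilbertSpace c)) := rfl
  rw [h, smul_smul, mul_inv_cancel₀ Complex.I_ne_zero, one_smul, sub_add_cancel,
    ← infinitesimalShift_graph]
  exact LinearPMap.mem_graph _ ⟨(x : HilbertSpace c), hx⟩

theorem weightedFourier_momentum (c : ℝ) (x : (momentum c).domain) :
    weightedFourier c (momentum c x) =ᵐ[volume]
      fun ξ : ℝ => (2 * π * ξ : ℂ) * weightedFourier c x ξ := by
  have h := (mem_shiftGraph_iff_fourier c _ _).1 (smul_momentum_mem_shiftGraph c x)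
  rw [add_sub_cancel_right, map_smul] at h
  filter_upwards [h, Lp.coeFn_smul Complex.I (weightedFourier c (momentum c x))] with ξ h1 h2
  rw [h2, Pi.smul_apply, smul_eq_mul] at h1
  refine mul_left_cancel₀ Complex.I_ne_zero ?_
  rw [h1]
  ring

theorem mem_domain_momentum_iff_memLp (c : ℝ) (x : HilbertSpace c) :
    x ∈ (momentum c).domain ↔
      MemLp (fun ξ : ℝ => (2 * π * ξ : ℂ) * weightedFourier c x ξ) 2 volume := by
  constructor
  · intro hx
    exact (memLp_congr_ae (weightedFourier_momentum c ⟨x, hx⟩)).1 (Lp.memLp _)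
  · intro h
    rw [mem_domain_momentum_iff]
    have h' : MemLp (fun ξ : ℝ => 2 * π * Complex.I * ξ * weightedFourier c x ξ) 2 volume := by
      convert! h.const_mul Complex.I using 1
      ext ξ
      ring
    refine ⟨(weightedFourier c).symm (h'.toLp _) + (c : ℂ) • x, ?_⟩
    rw [mem_shiftGraph_iff_fourier, add_sub_cancel_right, LinearIsometryEquiv.apply_symm_apply]
    exact h'.coeFn_toLp

/-- The spectral measure of the momentum operator, whose support contains the real line. -/
theorem exists_resolution_momentum (c : ℝ) : ∃ E : ResolutionOfIdentity (HilbertSpace c),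
    E.IsIntegral (fun z => z) (momentum c) ∧
      ∀ (v r : ℝ), 0 < r → E.proj (Metric.ball (v : ℂ) r) ≠ 0 := by
  have hm : Measurable fun ξ : ℝ => (2 * π * ξ : ℂ) := by fun_prop
  refine ⟨multiplicationResolution (weightedFourier c) _ hm,
    isIntegral_multiplicationResolution _ hm _ (mem_domain_momentum_iff_memLp c)
      (weightedFourier_momentum c), fun v r hr => ?_⟩
  have hδ : 0 < r / (2 * π) := by positivity
  refine proj_multiplicationResolution_ne_zero _ hm measurableSet_ball
    (u := Metric.ball (v / (2 * π)) (r / (2 * π))) measurableSet_ball ?_ ?_ ?_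
  · intro ξ hξ
    rw [Metric.mem_ball, Real.dist_eq, lt_div_iff₀ (by positivity)] at hξ
    rw [mem_preimage, Metric.mem_ball, Complex.dist_eq]
    have e : (2 * π * ξ - v : ℂ) = (((ξ - v / (2 * π)) * (2 * π) : ℝ) : ℂ) := by
      push_cast
      field_simp
    rwa [e, Complex.norm_real, Real.norm_eq_abs, abs_mul, abs_of_pos Real.two_pi_pos]
  · exact (Metric.measure_ball_pos volume _ hδ).ne'
  · exact measure_ball_lt_top.ne

end Momentum

section Truncation

open Filter Topology

theorem ResolutionOfIdentity.IsIntegral.constOp_add_smul {H : Type*} [NormedAddCommGroup H]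
    [InnerProductSpace ℂ H] [CompleteSpace H] {E : ResolutionOfIdentity H} {f : ℂ → ℂ}
    {A : H →ₗ.[ℂ] H} (hA : E.IsIntegral f A) (hf : Measurable f) {M : ℝ} (hM : ∀ z, ‖f z‖ ≤ M)
    (a b : ℂ) : E.IsIntegral (fun z => a + b * f z) (constOp H a + b • A) := by
  have hdom : ∀ x, x ∈ A.domain := fun x => by
    have := hA.proj_mem_domain_of_bounded .univ (fun z _ => hM z) x
    rwa [E.univ, one_apply_eq_self] at this
  refine ⟨fun x => iff_of_true ⟨trivial, hdom x⟩ ?_, fun x => ?_⟩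
  · calc ∫⁻ z, ‖a + b * f z‖ₑ ^ 2 ∂(E.scalarMeasure x)
        ≤ ∫⁻ _, ENNReal.ofReal (‖a‖ + ‖b‖ * M) ^ 2 ∂(E.scalarMeasure x) := by
          refine lintegral_mono fun z => ?_
          gcongr
          rw [← ofReal_norm]
          refine ENNReal.ofReal_le_ofReal ((norm_add_le _ _).trans ?_)
          rw [norm_mul]
          gcongr
          exact hM z
      _ < ∞ := by
          rw [lintegral_const]
          exact ENNReal.mul_lt_top (by simp) (measure_lt_top _ _)
  · have hx : (constOp H a + b • A) x = a • (x : H) + b • A ⟨x, hdom x⟩ := rfl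
    rw [hx, inner_add_right, inner_smul_right, inner_smul_right,
      hA.2 ⟨x, hdom x⟩, integral_add (integrable_const _)
        ((hA.integrable hf (hdom x)).const_mul b), integral_const_mul, integral_const,
      E.real_scalarMeasure_univ, inner_self_eq_norm_sq_to_K, Complex.real_smul, mul_comm a]
    simp

theorem measurable_riemannZeta : Measurable riemannZeta := by
  refine measurable_of_continuousOn_compl_singleton 1 fun s hs => ?_
  exact (differentiableAt_riemannZeta hs).continuousAt.continuousWithinAt

theorem IsAdmissibleCutoff.mem_Icc {T : ℝ} {φ : ℝ → ℝ} (hφ : IsAdmissibleCutoff T φ) (v : ℝ) :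
    φ v ∈ Icc (-T) T :=
  hφ.2 ▸ subset_closure (mem_range_self v)

/-- The truncated shift has a spectral measure whose support is the segment `c + i [-T, T]`. -/
theorem exists_resolution_truncatedShift (c : ℝ) {T : ℝ} {φ : ℝ → ℝ}
    (hφ : IsAdmissibleCutoff T φ) : ∃ E : ResolutionOfIdentity (HilbertSpace c),
      E.IsIntegral (fun z => z) (truncatedShift c φ) ∧
      E.proj ((fun τ : ℝ => (c + Complex.I * τ : ℂ)) '' Icc (-T) T)ᶜ = 0 ∧
      ∀ τ ∈ Icc (-T) T, ∀ r : ℝ, 0 < r → E.proj (Metric.ball (c + Complex.I * τ : ℂ) r) ≠ 0 := by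
  obtain ⟨E₀, hE₀, hsupp₀⟩ := exists_resolution_momentum c
  have hmeas : Measurable fun z : ℂ => (φ z.re : ℂ) :=
    Complex.measurable_ofReal.comp (hφ.1.measurable.comp Complex.measurable_re)
  have hbound : ∀ z : ℂ, ‖(φ z.re : ℂ)‖ ≤ T := fun z => by
    rw [Complex.norm_real, Real.norm_eq_abs]
    exact abs_le.2 (hφ.mem_Icc z.re)
  obtain ⟨A₀, hA₀⟩ := E₀.exists_isIntegral_of_bounded hmeas hbound
  obtain ⟨E, hE, hA⟩ := isFunctionOf_functionalCalculus
    (⟨E₀, hE₀, hA₀⟩ : IsFunctionOf (fun z => (φ z.re : ℂ)) (momentum c) A₀)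
  have hh : Measurable fun z : ℂ => (c + Complex.I * φ z.re : ℂ) :=
    (hmeas.const_mul Complex.I).const_add _
  refine ⟨E.map _ hh, (ResolutionOfIdentity.isIntegral_map_iff measurable_id hh).2
    (hA.constOp_add_smul hmeas hbound _ _), ?_, fun τ hτ r hr => ?_⟩
  · change E.proj _ = 0
    have : (fun z : ℂ => (c + Complex.I * φ z.re : ℂ)) ⁻¹'
        ((fun τ : ℝ => (c + Complex.I * τ : ℂ)) '' Icc (-T) T)ᶜ = ∅ := by
      rw [preimage_compl, compl_empty_iff, eq_univ_iff_forall]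
      exact fun z => ⟨φ z.re, hφ.mem_Icc z.re, rfl⟩
    rw [this, E.empty]
  · obtain ⟨_, ⟨v, rfl⟩, hv⟩ := Metric.mem_closure_iff.1 (hφ.2 ▸ hτ) r hr
    obtain ⟨δ, hδ, hδφ⟩ := Metric.continuousAt_iff.1 hφ.1.continuousAt (r - dist τ (φ v))
      (sub_pos.2 hv)
    intro h0
    refine hE₀.proj_ball_ne_zero hE (l := (v : ℂ)) (fun r hr => hsupp₀ v r hr) hδ ?_
    have hsub : Metric.ball (v : ℂ) δ ⊆ (fun z : ℂ => (c + Complex.I * φ z.re : ℂ)) ⁻¹'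
        Metric.ball (c + Complex.I * τ : ℂ) r := by
      intro z hz
      have h1 : dist z.re v < δ := by
        rw [Real.dist_eq]
        refine lt_of_le_of_lt ?_ (Metric.mem_ball.1 hz)
        rw [Complex.dist_eq]
        simpa using Complex.abs_re_le_norm (z - v)
      have h2 := hδφ h1
      rw [mem_preimage, Metric.mem_ball, dist_add_left, dist_eq_norm, ← mul_sub, norm_mul,
        Complex.norm_I, one_mul, ← Complex.ofReal_sub, Complex.norm_real, ← dist_eq_norm]
      linarith [dist_triangle (φ z.re) (φ v) τ, dist_comm τ (φ v)]
    have h3 : E.proj (Metric.ball (v : ℂ) δ) = E.proj (Metric.ball (v : ℂ) δ) *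
        E.proj ((fun z : ℂ => (c + Complex.I * φ z.re : ℂ)) ⁻¹'
          Metric.ball (c + Complex.I * τ : ℂ) r) := by
      rw [← E.inter _ _ measurableSet_ball (hh measurableSet_ball),
        inter_eq_self_of_subset_left hsub]
    have h0' : E.proj ((fun z : ℂ => (c + Complex.I * φ z.re : ℂ)) ⁻¹'
          Metric.ball (c + Complex.I * τ : ℂ) r) = 0 := h0
    rw [h3, h0', mul_zero]

/-- The truncated spectral operator is invertible if and only if `ζ` has no zeros on the segment
`c + i [-T, T]`. -/
theorem isInvertible_truncatedSpectralOperator_iff {c : ℝ} (hc : c ≠ 1) {T : ℝ} {φ : ℝ → ℝ}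
    (hφ : IsAdmissibleCutoff T φ) : IsInvertible (truncatedSpectralOperator c φ) ↔
      ∀ τ ∈ Icc (-T) T, riemannZeta (c + Complex.I * τ) ≠ 0 := by
  obtain ⟨E₀, hE₀, hnull₀, hsupp₀⟩ := exists_resolution_truncatedShift c hφ
  set K : Set ℂ := (fun τ : ℝ => (c + Complex.I * τ : ℂ)) '' Icc (-T) T with hKdef
  have hK : IsCompact K := isCompact_Icc.image (by fun_prop)
  have hKm : MeasurableSet K := hK.measurableSet
  have hK1 : ∀ z ∈ K, z ≠ 1 := by
    rintro _ ⟨τ, -, rfl⟩ h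
    apply hc
    simpa using congrArg Complex.re h
  have hcont : ContinuousOn riemannZeta K := fun z hz =>
    (differentiableAt_riemannZeta (hK1 z hz)).continuousAt.continuousWithinAt
  obtain ⟨M, hM⟩ := hK.exists_bound_of_continuousOn hcont
  have hζ := measurable_riemannZeta
  obtain ⟨A₀, hA₀⟩ := E₀.exists_isIntegral_of_bounded (g := K.indicator riemannZeta)
    (hζ.indicator hKm) (M := |M|) fun z => by
      by_cases hz : z ∈ K
      · rw [indicator_of_mem hz]; exact (hM z hz).trans (le_abs_self M)
      · rw [indicator_of_notMem hz, norm_zero]; positivity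
  have hA₀' : E₀.IsIntegral riemannZeta A₀ := hA₀.congr fun x => by
    filter_upwards [E₀.ae_mem_of_proj_compl_eq_zero hKm hnull₀ x] with z hz
    rw [indicator_of_mem hz]
  obtain ⟨E, hE, hA⟩ := isFunctionOf_functionalCalculus
    (⟨E₀, hE₀, hA₀'⟩ : IsFunctionOf riemannZeta (truncatedShift c φ) A₀)
  change E.IsIntegral riemannZeta (truncatedSpectralOperator c φ) at hA
  constructor
  · intro hinv τ hτ h0
    obtain ⟨d, hd, hEd⟩ := hA.exists_proj_norm_lt_eq_zero_of_isInvertible hζ hinv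
    have hc' := (differentiableAt_riemannZeta (hK1 _ ⟨τ, hτ, rfl⟩)).continuousAt
    obtain ⟨r, hr, hrζ⟩ := Metric.continuousAt_iff.1 hc' d hd
    refine hE₀.proj_ball_ne_zero hE (hsupp₀ τ hτ) hr ?_
    have hsub : Metric.ball (c + Complex.I * τ : ℂ) r ⊆ {z | ‖riemannZeta z‖ < d} := by
      intro z hz
      have := hrζ (Metric.mem_ball.1 hz)
      rwa [h0, dist_zero_right] at this
    rw [← inter_eq_self_of_subset_left hsub, E.inter _ _ measurableSet_ball
      (measurableSet_lt hζ.norm measurable_const), hEd, mul_zero]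
  · intro hne
    have hnull : E.proj Kᶜ = 0 := by
      refine E.proj_compl_eq_zero hKm fun l hl => ?_
      by_contra! hcon
      obtain ⟨r, hr, hrK⟩ := Metric.isOpen_iff.1 hK.isClosed.isOpen_compl l hl
      refine hE.proj_ball_ne_zero hE₀ hcon hr ?_
      rw [← inter_eq_self_of_subset_left hrK, E₀.inter _ _ measurableSet_ball hKm.compl, hnull₀,
        mul_zero]
    obtain ⟨d, hd, hdK⟩ : ∃ d : ℝ, 0 < d ∧ ∀ z ∈ K, d ≤ ‖riemannZeta z‖ := by
      rcases K.eq_empty_or_nonempty with hempty | hnonempty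
      · exact ⟨1, one_pos, by simp [hempty]⟩
      · obtain ⟨z₀, hz₀, hmin⟩ := hK.exists_isMinOn hnonempty hcont.norm
        refine ⟨‖riemannZeta z₀‖, ?_, fun z hz => hmin hz⟩
        obtain ⟨τ, hτ, rfl⟩ := hz₀
        exact norm_pos_iff.2 (hne τ hτ)
    exact hA.isInvertible hζ hKm hnull hd hdK hM

end Truncation

section RiemannHypothesis

/-- The Riemann hypothesis follows from the absence of zeros in the strip `1/2 < re s < 1`. -/
theorem riemannHypothesis_of_strip
    (h : ∀ s : ℂ, 1 / 2 < s.re → s.re < 1 → riemannZeta s ≠ 0) : RiemannHypothesis := by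
  have h' : ∀ s : ℂ, 1 / 2 < s.re → riemannZeta s ≠ 0 := fun s hs => by
    rcases lt_or_ge s.re 1 with h1 | h1
    · exact h s hs h1
    · exact riemannZeta_ne_zero_of_one_le_re h1
  intro s hs htriv hs1
  rcases lt_trichotomy s.re (1 / 2) with hlt | heq | hgt
  · exfalso
    have hw : 1 / 2 < (1 - s).re := by
      rw [Complex.sub_re, Complex.one_re]; linarith
    have hw1 : 1 - s ≠ 1 := by
      intro he
      rw [sub_eq_self] at he
      rw [he, riemannZeta_zero] at hs
      norm_num at hs
    have hwn : ∀ n : ℕ, 1 - s ≠ -n := fun n he => by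
      rw [he] at hw
      simp only [Complex.neg_re, Complex.natCast_re] at hw
      linarith [Nat.cast_nonneg (α := ℝ) n]
    have hfe := riemannZeta_one_sub hwn hw1
    rw [sub_sub_cancel, hs] at hfe
    have hpow : (2 * Real.pi : ℂ) ^ (-(1 - s)) ≠ 0 := by
      rw [Complex.cpow_def_of_ne_zero (by simp [Real.pi_ne_zero])]
      exact Complex.exp_ne_zero _
    have hΓ : Complex.Gamma (1 - s) ≠ 0 := Complex.Gamma_ne_zero hwn
    have hcos : Complex.cos (Real.pi * (1 - s) / 2) = 0 := by
      by_contra hne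
      exact mul_ne_zero (mul_ne_zero (mul_ne_zero (mul_ne_zero two_ne_zero hpow) hΓ) hne)
        (h' _ hw) hfe.symm
    obtain ⟨k, hk⟩ := Complex.cos_eq_zero_iff.1 hcos
    have hπ : (Real.pi : ℂ) ≠ 0 := Complex.ofReal_ne_zero.2 Real.pi_ne_zero
    have hwk : 1 - s = 2 * k + 1 := by
      field_simp at hk
      exact hk
    have hsk : s = -2 * k := by linear_combination -hwk
    have hkre : (0 : ℝ) < 2 * k + 1 := by
      have := congrArg Complex.re hwk
      simp only [Complex.add_re, Complex.mul_re, Complex.re_ofNat, Complex.intCast_re,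
        Complex.im_ofNat, Complex.intCast_im, Complex.one_re] at this
      linarith
    have hk0 : 0 ≤ k := by
      have : (0 : ℤ) < 2 * k + 1 := by exact_mod_cast hkre
      omega
    obtain ⟨n, rfl⟩ := Int.eq_ofNat_of_zero_le hk0
    cases n with
    | zero => exact hw1 (by rw [hwk]; simp)
    | succ n => exact htriv ⟨n, by rw [hsk]; push_cast; ring⟩
  · exact heq
  · exact absurd hs (h' s hgt)

/-- Under the Riemann hypothesis `ζ` has no zeros with `re s > 0`, `re s ≠ 1/2`, apart from the
excluded point `1`. -/
theorem riemannZeta_ne_zero_of_riemannHypothesis (hRH : RiemannHypothesis) {s : ℂ}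
    (h0 : 0 < s.re) (h1 : s ≠ 1) (h2 : s.re ≠ 1 / 2) : riemannZeta s ≠ 0 := by
  intro hs
  refine h2 (hRH s hs ?_ h1)
  rintro ⟨n, hn⟩
  rw [hn] at h0
  simp at h0
  linarith [Nat.cast_nonneg (α := ℝ) n]

end RiemannHypothesis

end SpectralOperator

open SpectralOperator in
theorem riemannHypothesis_of_isQuasiInvertible {φ : ℝ → ℝ → ℝ → ℝ}
    (hφ : ∀ c ∈ Set.Ioo (0 : ℝ) 1, ∀ T : ℝ, 0 < T → IsAdmissibleCutoff T (φ c T))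
    (h : ∀ c ∈ Set.Ioo (1 / 2 : ℝ) 1, IsQuasiInvertible c (φ c)) : RiemannHypothesis := by
  refine riemannHypothesis_of_strip fun s hs1 hs2 => ?_
  have hT : 0 < |s.im| + 1 := by positivity
  have hadm := hφ s.re ⟨by linarith, hs2⟩ _ hT
  have := (isInvertible_truncatedSpectralOperator_iff hs2.ne hadm).1 (h s.re ⟨hs1, hs2⟩ _ hT) s.im
    ⟨by linarith [neg_abs_le s.im], by linarith [le_abs_self s.im]⟩
  rwa [mul_comm, Complex.re_add_im] at this

open SpectralOperator in
theorem isQuasiInvertible_of_riemannHypothesis {φ : ℝ → ℝ → ℝ → ℝ}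
    (hφ : ∀ c ∈ Set.Ioo (0 : ℝ) 1, ∀ T : ℝ, 0 < T → IsAdmissibleCutoff T (φ c T))
    (hRH : RiemannHypothesis) {c : ℝ} (hc : c ∈ Set.Ioo (0 : ℝ) 1 \ {1 / 2}) :
    IsQuasiInvertible c (φ c) := by
  intro T hT
  rw [isInvertible_truncatedSpectralOperator_iff hc.1.2.ne (hφ c hc.1 T hT)]
  intro τ _
  have hre : (c + Complex.I * τ : ℂ).re = c := by simp
  refine riemannZeta_ne_zero_of_riemannHypothesis hRH (hre.symm ▸ hc.1.1) (fun h => ?_)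
    (hre.symm ▸ hc.2)
  rw [h, Complex.one_re] at hre
  exact hc.1.2.ne hre.symm

theorem theorem6p1 (φ : ℝ → ℝ → ℝ → ℝ)
    (hφ : ∀ c ∈ Set.Ioo (0 : ℝ) 1, ∀ T : ℝ, 0 < T → SpectralOperator.IsAdmissibleCutoff T (φ c T)) :
    ((∀ c ∈ Set.Ioo (0 : ℝ) 1 \ {1 / 2}, SpectralOperator.IsQuasiInvertible c (φ c)) ↔
      RiemannHypothesis) ∧
    ((∀ c ∈ Set.Ioo (1 / 2 : ℝ) 1, SpectralOperator.IsQuasiInvertible c (φ c)) ↔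
      RiemannHypothesis) := by
  have hsub : ∀ c ∈ Set.Ioo (1 / 2 : ℝ) 1, c ∈ Set.Ioo (0 : ℝ) 1 \ {1 / 2} := fun c hc =>
    ⟨⟨by linarith [hc.1], hc.2⟩, hc.1.ne'⟩
  exact ⟨⟨fun h => riemannHypothesis_of_isQuasiInvertible hφ fun c hc => h c (hsub c hc),
      fun hRH _ hc => isQuasiInvertible_of_riemannHypothesis hφ hRH hc⟩,
    ⟨riemannHypothesis_of_isQuasiInvertible hφ,
      fun hRH c hc => isQuasiInvertible_of_riemannHypothesis hφ hRH (hsub c hc)⟩⟩
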